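/- Let $d\ge 1$. Let $\varphi(\xi)=\varphi_0(|\xi|)$ on $\mathbb R^d$, where $\varphi_0:[0,\infty)\to[0,\infty)$ is non-increasing, $\int_{\mathbb R^d}\varphi(\xi)(1+|\xi|^2)\,d\xi<\infty$, and $\varphi$ is not almost everywhere zero; set $\varphi_\varepsilon(\xi)=\varepsilon^{-d}\varphi(\xi/\varepsilon)$. Let $E=\bigcup_{k\in\mathbb Z^d}(k+K)$, where $K\subset\mathbb R^d$ is the closure of a nonempty connected open set, has boundary of zero Lebesgue measure, and satisfies $(k+K)\cap K=\emptyset$ for every $k\in\mathbb Z^d\setminus\{0\}$. Let $\Omega\subset\mathbb R^d$ be a nonempty, connected, bounded open set with Lipschitz boundary. For $\delta,\varepsilon>0$ and $u\in L^2(\Omega)$ define $$F_{\delta,\varepsilon}(u)=\frac1{\varepsilon^2}\int_{(\Omega\cap\delta E)\times(\Omega\cap\delta E)}\varphi_\varepsilon(x-y)\,|u(x)-u(y)|^2\,dx\,dy .$$ **Theorem.** For each $\varepsilon>0$ let $\delta=\delta_\varepsilon>0$ and $u_\varepsilon\in L^2(\Omega)$ be such that $\lim_{\varepsilon\to0}\varepsilon/\delta_\varepsilon=+\infty$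 and $\sup_{\varepsilon>0}F_{\delta_\varepsilon,\varepsilon}(u_\varepsilon)<+\infty$. Let $u^\varepsilon_k\in\mathbb R$ $(k\in\mathbb Z^d)$ satisfy $$u^\varepsilon_k=\frac1{|\delta_\varepsilon E\cap\varepsilon(k+[0,1]^d)|}\int_{\delta_\varepsilon E\cap\varepsilon(k+[0,1]^d)}u_\varepsilon\,dx\qquad\text{whenever }\varepsilon(k+[0,1]^d)\subseteq\Omega,$$ the remaining values being arbitrary (the average is taken to be $0$ if $|\delta_\varepsilon E\cap\varepsilon(k+[0,1]^d)|=0$, which can occur for a cube contained in $\Omega$ only if $\varepsilon$ is not small). Let $\overline u_\varepsilon:\mathbb R^d\to\mathbb R$ be the piecewise-affine interpolation of $\varepsilon k\mapsto u^\varepsilon_k$ on Kuhn's decomposition of the cubes $\varepsilon(k+[0,1]^d)$; that is, $\overline u_\varepsilon$ is affine on each of the simplexes $\{\varepsilon(k+t): 1\ge t_{\sigma(1)}\ge\dots\ge t_{\sigma(d)}\ge0\}$, with $k\in\mathbb Z^d$ and $\sigma$ a permutation of $\{1,\dots,d\}$, and $\overline u_\varepsilon(\varepsilon k)=u^\varepsilon_k$.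 Then for every sequence $\varepsilon_j\to0$ of positive numbers: 1. there are a subsequence $\varepsilon_{j_i}$, constants $c_i\in\mathbb R$ and a function $u\in H^1(\Omega)$ such that $\overline u_{\varepsilon_{j_i}}+c_i\to u$ in $L^2_{\rm loc}(\Omega)$, that is, in $L^2(C)$ for every compact $C\subset\Omega$; 2. whenever $\overline u_{\varepsilon_{j_i}}+c_i\to u$ in $L^2_{\rm loc}(\Omega)$ for some subsequence, some constants $c_i\in\mathbb R$ and some $u\in L^2_{\rm loc}(\Omega)$, the limit $u$ lies in $H^1(\Omega)$. -/

import Mathlib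

open MeasureTheory Filter Topology Set
open scoped NNReal ENNReal Pointwise ContDiff

/-- The integer vector `k`, seen as a point of `ℝ^d`. -/
def latticeVec {d : ℕ} (k : Fin d → ℤ) : EuclideanSpace ℝ (Fin d) :=
  WithLp.toLp 2 (fun i => (k i : ℝ))

/-- `φ` is a radial convolution kernel: `φ(ξ) = φ₀(|ξ|)` with `φ₀ : [0,∞) → [0,∞)` decreasing
(in the wide sense), and `∫ φ(ξ) (1 + |ξ|²) dξ < ∞`. -/
def IsRadialKernel {d : ℕ} (φ : EuclideanSpace ℝ (Fin d) → ℝ) : Prop :=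
  (∃ φ₀ : ℝ≥0 → ℝ≥0, Antitone φ₀ ∧ ∀ ξ, φ ξ = (φ₀ ‖ξ‖₊ : ℝ)) ∧
    Integrable (fun ξ => φ ξ * (1 + ‖ξ‖ ^ 2)) volume

/-- The scaled kernel `φ_ε(ξ) = ε^{-d} φ(ξ/ε)`. -/
noncomputable def scaledKernel {d : ℕ} (φ : EuclideanSpace ℝ (Fin d) → ℝ) (ε : ℝ)
    (ξ : EuclideanSpace ℝ (Fin d)) : ℝ :=
  (ε ^ d)⁻¹ * φ (ε⁻¹ • ξ)

/-- `K` is the closure of a nonempty connected open set, its boundary is Lebesgue-null, and it is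
disjoint from all its translates by nonzero integer vectors. -/
structure IsInclusion {d : ℕ} (K : Set (EuclideanSpace ℝ (Fin d))) : Prop where
  closure_open : ∃ U : Set (EuclideanSpace ℝ (Fin d)), IsOpen U ∧ IsConnected U ∧ K = closure U
  frontier_null : volume (frontier K) = 0
  disjoint_translates : ∀ k : Fin d → ℤ, k ≠ 0 → Disjoint (latticeVec k +ᵥ K) K

/-- The `1`-periodic set `E = ⋃_{k ∈ ℤ^d} (k + K)`. -/
def periodicSet {d : ℕ} (K : Set (EuclideanSpace ℝ (Fin d))) : Set (EuclideanSpace ℝ (Fin d)) :=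
  ⋃ k : Fin d → ℤ, latticeVec k +ᵥ K

/-- `Ω` has Lipschitz boundary: near each boundary point, in suitable orthogonal coordinates with
vertical unit vector `ν`, it is the strict epigraph of a Lipschitz function `g` of the horizontal
component `y - ⟨y, ν⟩ ν`. -/
def HasLipschitzBoundary {d : ℕ} (Ω : Set (EuclideanSpace ℝ (Fin d))) : Prop :=
  ∀ x ∈ frontier Ω, ∃ (r : ℝ) (ν : EuclideanSpace ℝ (Fin d)) (L : ℝ≥0)
    (g : EuclideanSpace ℝ (Fin d) → ℝ), 0 < r ∧ ‖ν‖ = 1 ∧ LipschitzWith L g ∧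
      ∀ y ∈ Metric.ball x r, y ∈ Ω ↔ g (y - inner ℝ y ν • ν) < inner ℝ y ν

/-- The nonlocal energy
`F_{δ,ε}(u) = ε^{-2} ∫_{(Ω ∩ δE) × (Ω ∩ δE)} φ_ε(x - y) |u(x) - u(y)|² dx dy`. -/
noncomputable def nonlocalEnergy {d : ℕ} (φ : EuclideanSpace ℝ (Fin d) → ℝ)
    (Ω E : Set (EuclideanSpace ℝ (Fin d))) (δ ε : ℝ) (u : EuclideanSpace ℝ (Fin d) → ℝ) : ℝ≥0∞ :=
  ENNReal.ofReal (ε ^ 2)⁻¹ *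
    ∫⁻ z in (Ω ∩ δ • E) ×ˢ (Ω ∩ δ • E),
      ENNReal.ofReal (scaledKernel φ ε (z.1 - z.2) * |u z.1 - u z.2| ^ 2)

/-- The closed cube `ε (k + [0,1]^d)`. -/
def latticeCube {d : ℕ} (ε : ℝ) (k : Fin d → ℤ) : Set (EuclideanSpace ℝ (Fin d)) :=
  {x | ∀ i, ε * (k i : ℝ) ≤ x i ∧ x i ≤ ε * ((k i : ℝ) + 1)}

/-- The average of `u` over `δE ∩ ε (k + [0,1]^d)`. -/
noncomputable def cubeAverage {d : ℕ} (E : Set (EuclideanSpace ℝ (Fin d))) (δ ε : ℝ)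
    (u : EuclideanSpace ℝ (Fin d) → ℝ) (k : Fin d → ℤ) : ℝ :=
  (volume.real (δ • E ∩ latticeCube ε k))⁻¹ * ∫ x in δ • E ∩ latticeCube ε k, u x

/-- The `m`-th vertex `k + e_{σ(0)} + ⋯ + e_{σ(m-1)}` of the Kuhn simplex
`{k + t : 1 ≥ t_{σ(0)} ≥ ⋯ ≥ t_{σ(d-1)} ≥ 0}` of the cube `k + [0,1]^d`. -/
def kuhnVertex {d : ℕ} (k : Fin d → ℤ) (σ : Equiv.Perm (Fin d)) (m : ℕ) : Fin d → ℤ :=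
  fun i => k i + if (σ.symm i : ℕ) < m then 1 else 0

/-- The piecewise-affine interpolation, on Kuhn's decomposition of the cubes `ε (k + [0,1]^d)` into
`d!` simplexes, of the function `ε k ↦ v k` on `ε ℤ^d`. With `k = ⌊x/ε⌋`, `t = x/ε - k` and `σ` a
permutation for which `t_{σ(0)} ≥ ⋯ ≥ t_{σ(d-1)}`, the point `x` lies in the simplex of `σ`, and the
affine function that equals `v` at the vertices of this simplex is evaluated at `x`. -/
noncomputable def kuhnInterpolation {d : ℕ} (ε : ℝ) (v : (Fin d → ℤ) → ℝ)
    (x : EuclideanSpace ℝ (Fin d)) : ℝ :=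
  let k : Fin d → ℤ := fun i => ⌊x i / ε⌋
  let t : Fin d → ℝ := fun i => Int.fract (x i / ε)
  let σ : Equiv.Perm (Fin d) := Tuple.sort (fun i => -t i)
  v k + ∑ m : Fin d, t (σ m) * (v (kuhnVertex k σ (m + 1)) - v (kuhnVertex k σ m))

/-- `f j → u` in `L²_loc(Ω)`, that is, in `L²(C)` for every compact `C ⊆ Ω`. -/
def TendstoL2Loc {d : ℕ} (Ω : Set (EuclideanSpace ℝ (Fin d)))
    (f : ℕ → EuclideanSpace ℝ (Fin d) → ℝ) (u : EuclideanSpace ℝ (Fin d) → ℝ) : Prop :=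
  ∀ C : Set (EuclideanSpace ℝ (Fin d)), IsCompact C → C ⊆ Ω →
    (∀ j, MemLp (f j) 2 (volume.restrict C)) ∧ MemLp u 2 (volume.restrict C) ∧
      Tendsto (fun j => eLpNorm (fun x => f j x - u x) 2 (volume.restrict C)) atTop (𝓝 0)

/-- `u ∈ H¹(Ω)`: `u ∈ L²(Ω)`, and `u` has weak partial derivatives `g i ∈ L²(Ω)`. -/
def MemH1 {d : ℕ} (Ω : Set (EuclideanSpace ℝ (Fin d))) (u : EuclideanSpace ℝ (Fin d) → ℝ) : Prop :=
  MemLp u 2 (volume.restrict Ω) ∧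
    ∃ g : Fin d → EuclideanSpace ℝ (Fin d) → ℝ, ∀ i, MemLp (g i) 2 (volume.restrict Ω) ∧
      ∀ ψ : EuclideanSpace ℝ (Fin d) → ℝ, ContDiff ℝ ∞ ψ → HasCompactSupport ψ → tsupport ψ ⊆ Ω →
        ∫ x in Ω, u x * fderiv ℝ ψ x (EuclideanSpace.single i 1) = -∫ x in Ω, g i x * ψ x

/-! ### L² inequalities for averages and translates -/

section L2Tools

/-! Everything passes through one estimate, `TranslationBound`: the L²(C) norm of f(· + h) − f is at
most L(|h| + r) whenever the segments x + th, x ∈ C, keep distance r from the complement of Ω. The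
term r is there because a function built from averages at a small scale is not controlled below that
scale. For the interpolations r = βε, with β and L independent of ε.

The estimate comes from the energy. A nontrivial radial nonincreasing kernel is at least some c₀ > 0
on a ball of radius r₀, so the energy controls |u(x) − u(y)|² for x, y in A = Ω ∩ δE with |x − y| ≤
r₀ε. Since δ is small compared with ε, δE fills a fixed fraction of every ball of radius comparable
to ε (`IsInclusion.exists_volume_ball_le`). Interactions jump across the gaps between components of
δE, and Jensen's inequality compares averages over nearby pieces of A. With s = r₀ε/4, let U(x) be
the average of u over A ∩ B(x, s). Shifts of length at most s are estimated directly and longer ones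
by chaining (`translationBound_setAverage_ball`). Cube averages are L²-close to U
(`lintegral_setAverage_sub_setAverage_ball_le`), and the interpolation at x is governed by the
values at the vertices of the cube around x, so it is L²-close to U as well and inherits the bound
(`exists_translationBound_kuhnInterpolation`).

The rest uses only the translation bound. For compactness, the mean over one ball is subtracted,
connectedness of Ω spreads the resulting L² bound to all compact subsets, and averages over lattice
cells of side η approximate the functions up to O(η + r). Only finitely many cells meet a compact
set, so a subsequence along which all cell averages converge is Cauchy in L²_loc. For regularity, r
disappears in the limit: the limit moves by at most L|h|. Translating inwards across the Lipschitz
boundary gives u ∈ L²(Ω), and difference quotients with the Riesz theorem give the weak gradient. -/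

theorem eLpNorm_two_sq {α : Type*} [MeasurableSpace α] (f : α → ℝ) (μ : Measure α) :
    eLpNorm f 2 μ ^ 2 = ∫⁻ x, ‖f x‖ₑ ^ 2 ∂μ := by
  have := eLpNorm_nnreal_pow_eq_lintegral (f := f) (μ := μ) (p := 2) two_ne_zero
  simpa using this

theorem eLpNorm_two_le_iff {α : Type*} [MeasurableSpace α] (f : α → ℝ) (μ : Measure α)
    (b : ℝ≥0∞) : eLpNorm f 2 μ ≤ b ↔ ∫⁻ x, ‖f x‖ₑ ^ 2 ∂μ ≤ b ^ 2 := by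
  rw [← eLpNorm_two_sq]
  exact (ENNReal.pow_le_pow_left_iff two_ne_zero).symm

theorem enorm_sub_sq_le (a b c : ℝ) : ‖a - c‖ₑ ^ 2 ≤ 2 * ‖a - b‖ₑ ^ 2 + 2 * ‖b - c‖ₑ ^ 2 := by
  have h1 : (a - c) ^ 2 ≤ 2 * (a - b) ^ 2 + 2 * (b - c) ^ 2 := by
    nlinarith [sq_nonneg ((a - b) - (b - c))]
  simp only [Real.enorm_eq_ofReal_abs, ← ENNReal.ofReal_pow (abs_nonneg _), sq_abs]
  have h2 : (2 : ℝ≥0∞) = ENNReal.ofReal 2 := by simp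
  rw [h2, ← ENNReal.ofReal_mul (by norm_num), ← ENNReal.ofReal_mul (by norm_num),
    ← ENNReal.ofReal_add (by positivity) (by positivity)]
  exact ENNReal.ofReal_le_ofReal h1

/-- Translating the argument translates the domain of integration. -/
theorem eLpNorm_comp_add_right_restrict {E : Type*} [NormedAddCommGroup E] [MeasurableSpace E]
    [BorelSpace E] (μ : Measure E) [μ.IsAddRightInvariant] [SecondCountableTopology E]
    (f : E → ℝ) (p : ℝ≥0∞) (C : Set E) (h : E) :
    eLpNorm (fun x => f (x + h)) p (μ.restrict C) =
      eLpNorm f p (μ.restrict ((fun x => x + h) '' C)) := by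
  have hm : MeasurableEmbedding (fun x : E => x + h) := measurableEmbedding_addRight h
  have := (measurePreserving_add_right μ h).restrict_image_emb hm C
  rw [← this.map_eq, hm.eLpNorm_map_measure]
  rfl

/-- Jensen's inequality for the square of the distance of an average to a constant. -/
theorem enorm_sq_setAverage_sub_le {α : Type*} [MeasurableSpace α] {μ : Measure α} {S : Set α}
    (hS0 : μ S ≠ 0) (hS : μ S ≠ ⊤) {f : α → ℝ} (hf : IntegrableOn f S μ) (b : ℝ) :
    ‖(⨍ y in S, f y ∂μ) - b‖ₑ ^ 2 ≤ (μ S)⁻¹ * ∫⁻ y in S, ‖f y - b‖ₑ ^ 2 ∂μ := by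
  set ν : Measure α := (μ S)⁻¹ • μ.restrict S with hν
  have hνp : IsProbabilityMeasure ν := ⟨by simp [hν, ENNReal.inv_mul_cancel hS0 hS]⟩
  have hfν : Integrable f ν := hf.smul_measure (by simpa using hS0)
  have hav : (⨍ y in S, f y ∂μ) - b = ∫ y, (f y - b) ∂ν := by
    rw [integral_sub hfν (integrable_const b)]
    simp [average, hν]
  -- For the probability measure `ν` the L¹ norm is at most the L² norm, which is the case of
  -- Jensen's inequality needed here.
  have h1 : ‖∫ y, (f y - b) ∂ν‖ₑ ≤ eLpNorm (fun y => f y - b) 2 ν := by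
    refine (enorm_integral_le_lintegral_enorm _).trans ?_
    rw [← eLpNorm_one_eq_lintegral_enorm]
    exact eLpNorm_le_eLpNorm_of_exponent_le (by norm_num)
      (hfν.aestronglyMeasurable.sub aestronglyMeasurable_const)
  rw [hav]
  calc _ ≤ eLpNorm (fun y => f y - b) 2 ν ^ 2 := by gcongr
    _ = _ := by rw [eLpNorm_two_sq, hν, lintegral_smul_measure, smul_eq_mul]

/-- Substituting y = x + h replaces the moving ball by a fixed ball of shifts. Tonelli's theorem
then lets the translation estimate act for each h separately. -/
theorem lintegral_lintegral_closedBall_enorm_sq_le {E : Type*} [NormedAddCommGroup E]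
    [MeasurableSpace E] [BorelSpace E] [SecondCountableTopology E] (μ : Measure E)
    [μ.IsAddLeftInvariant] [SFinite μ] {f : E → ℝ} (hf : Measurable f) (C : Set E)
    {R : ℝ} {B : ℝ≥0∞}
    (hB : ∀ h ∈ Metric.closedBall (0 : E) R, ∫⁻ x in C, ‖f (x + h) - f x‖ₑ ^ 2 ∂μ ≤ B) :
    ∫⁻ x in C, ∫⁻ y in Metric.closedBall x R, ‖f y - f x‖ₑ ^ 2 ∂μ ∂μ ≤
      μ (Metric.closedBall 0 R) * B := by
  have hmeas : Measurable (fun z : E × E => ‖f (z.1 + z.2) - f z.1‖ₑ ^ 2) := by fun_prop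
  have htr : ∀ x, ∫⁻ y in Metric.closedBall x R, ‖f y - f x‖ₑ ^ 2 ∂μ =
      ∫⁻ h in Metric.closedBall (0 : E) R, ‖f (x + h) - f x‖ₑ ^ 2 ∂μ := by
    intro x
    have hm : MeasurableEmbedding (fun h : E => x + h) := measurableEmbedding_addLeft x
    have hp := (measurePreserving_add_left μ x).restrict_image_emb hm (Metric.closedBall 0 R)
    have himg : (fun h : E => x + h) '' Metric.closedBall 0 R = Metric.closedBall x R := by
      simp
    rw [himg] at hp
    rw [← hp.map_eq, hm.lintegral_map]
  simp only [htr]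
  calc ∫⁻ x in C, ∫⁻ h in Metric.closedBall (0 : E) R, ‖f (x + h) - f x‖ₑ ^ 2 ∂μ ∂μ
      = ∫⁻ h in Metric.closedBall (0 : E) R, ∫⁻ x in C, ‖f (x + h) - f x‖ₑ ^ 2 ∂μ ∂μ := by
        rw [lintegral_lintegral_swap hmeas.aemeasurable]
    _ ≤ ∫⁻ h in Metric.closedBall (0 : E) R, B ∂μ :=
        setLIntegral_mono' Metric.isClosed_closedBall.measurableSet hB
    _ = _ := by rw [setLIntegral_const, mul_comm B]

/-- The distance from `f` to its averages over sets of size `R` is controlled by the translates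
of `f`. -/
theorem lintegral_enorm_sq_setAverage_sub_le {E : Type*} [NormedAddCommGroup E]
    [MeasurableSpace E] [BorelSpace E] [SecondCountableTopology E] (μ : Measure E)
    [μ.IsAddLeftInvariant] [SFinite μ] {f : E → ℝ} (hf : Measurable f) {C : Set E}
    (hC : MeasurableSet C) {S : E → Set E} {R : ℝ} {c : ℝ≥0∞} (hc0 : c ≠ 0)
    (hS : ∀ x ∈ C, S x ⊆ Metric.closedBall x R) (hSc : ∀ x ∈ C, c ≤ μ (S x))
    (hSfin : ∀ x ∈ C, μ (S x) ≠ ⊤) (hSint : ∀ x ∈ C, IntegrableOn f (S x) μ) {B : ℝ≥0∞}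
    (hB : ∀ h ∈ Metric.closedBall (0 : E) R, ∫⁻ x in C, ‖f (x + h) - f x‖ₑ ^ 2 ∂μ ≤ B) :
    ∫⁻ x in C, ‖(⨍ y in S x, f y ∂μ) - f x‖ₑ ^ 2 ∂μ ≤
      c⁻¹ * (μ (Metric.closedBall 0 R) * B) := by
  have hpt : ∀ x ∈ C, ‖(⨍ y in S x, f y ∂μ) - f x‖ₑ ^ 2 ≤
      c⁻¹ * ∫⁻ y in Metric.closedBall x R, ‖f y - f x‖ₑ ^ 2 ∂μ := by
    intro x hx
    have h0 : μ (S x) ≠ 0 := (lt_of_lt_of_le (pos_iff_ne_zero.2 hc0) (hSc x hx)).ne'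
    refine (enorm_sq_setAverage_sub_le h0 (hSfin x hx) (hSint x hx) (f x)).trans ?_
    exact mul_le_mul' (ENNReal.inv_le_inv.2 (hSc x hx)) (lintegral_mono_set (hS x hx))
  refine (setLIntegral_mono' hC hpt).trans ?_
  refine (lintegral_const_mul' c⁻¹ _ (ENNReal.inv_ne_top.2 hc0)).le.trans ?_
  exact mul_le_mul_right (lintegral_lintegral_closedBall_enorm_sq_le μ hf C hB) _

end L2Tools

/-! ### Translation bounds with a scale -/

section TranslationBound

variable {E : Type*} [NormedAddCommGroup E] [NormedSpace ℝ E]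

/-- The translates of `f` in `L²` move at most linearly, up to an error of size `r`, as long as
the translation path stays at distance `r` from the complement of `Ω`. -/
def TranslationBound [MeasureSpace E] (Ω : Set E) (r L : ℝ) (f : E → ℝ) : Prop :=
  ∀ (C : Set E) (h : E), MeasurableSet C →
    (∀ x ∈ C, ∀ t ∈ Icc (0 : ℝ) 1, Metric.closedBall (x + t • h) r ⊆ Ω) →
    eLpNorm (fun x => f (x + h) - f x) 2 (volume.restrict C) ≤ ENNReal.ofReal (L * (‖h‖ + r))

theorem TranslationBound.add_const [MeasureSpace E] {Ω : Set E} {r L : ℝ} {f : E → ℝ}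
    (hf : TranslationBound Ω r L f) (c : ℝ) : TranslationBound Ω r L (fun x => f x + c) := by
  intro C h hC hh
  simpa using hf C h hC hh

/-- The image of a compact set under a translation path contained in an open set stays at a
positive distance from the complement. -/
theorem IsCompact.exists_pos_closedBall_segment_subset {C Ω : Set E}
    (hC : IsCompact C) (hΩ : IsOpen Ω) (h : E)
    (hh : ∀ x ∈ C, ∀ t ∈ Icc (0 : ℝ) 1, x + t • h ∈ Ω) :
    ∃ r > 0, ∀ x ∈ C, ∀ t ∈ Icc (0 : ℝ) 1, Metric.closedBall (x + t • h) r ⊆ Ω := by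
  have hK : IsCompact ((fun z : E × ℝ => z.1 + z.2 • h) '' (C ×ˢ Icc (0 : ℝ) 1)) :=
    (hC.prod isCompact_Icc).image (by fun_prop)
  obtain ⟨r, hr, hsub⟩ := hK.exists_cthickening_subset_open hΩ (by
    rintro _ ⟨⟨x, t⟩, ⟨hx, ht⟩, rfl⟩
    exact hh x hx t ht)
  refine ⟨r, hr, fun x hx t ht => ?_⟩
  exact (Metric.closedBall_subset_cthickening (mem_image_of_mem _ (mk_mem_prod hx ht)) r).trans hsub

end TranslationBound

/-! ### Limits of translation bounds, and integrability up to the boundary -/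

section Limit

variable {d : ℕ}

theorem image_add_right_subset_of_segment {E : Type*} [AddCommGroup E] [Module ℝ E]
    {C Ω : Set E} {h : E} (hh : ∀ x ∈ C, ∀ t ∈ Icc (0 : ℝ) 1, x + t • h ∈ Ω) :
    (fun x => x + h) '' C ⊆ Ω := by
  rintro _ ⟨x, hx, rfl⟩
  simpa using hh x hx 1 (by simp)

theorem aestronglyMeasurable_comp_add_right_restrict {E : Type*} [NormedAddCommGroup E]
    [MeasurableSpace E] [BorelSpace E] [SecondCountableTopology E] {μ : Measure E}
    [μ.IsAddRightInvariant] {f : E → ℝ} {C : Set E} {h : E}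
    (hf : AEStronglyMeasurable f (μ.restrict ((fun x => x + h) '' C))) :
    AEStronglyMeasurable (fun x => f (x + h)) (μ.restrict C) :=
  hf.comp_measurePreserving
    ((measurePreserving_add_right μ h).restrict_image_emb (measurableEmbedding_addRight h) C)

/-- Translation bounds pass to limits in `L²_loc`, where the error term disappears. -/
theorem TendstoL2Loc.eLpNorm_translate_sub_le {Ω : Set (EuclideanSpace ℝ (Fin d))}
    (hΩ : IsOpen Ω) {f : ℕ → EuclideanSpace ℝ (Fin d) → ℝ} {w : EuclideanSpace ℝ (Fin d) → ℝ}
    {r : ℕ → ℝ} {L : ℝ} (hr : Tendsto r atTop (𝓝 0))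
    (hf : ∀ᶠ j in atTop, TranslationBound Ω (r j) L (f j)) (hw : TendstoL2Loc Ω f w)
    {C : Set (EuclideanSpace ℝ (Fin d))} {h : EuclideanSpace ℝ (Fin d)} (hC : IsCompact C)
    (hh : ∀ x ∈ C, ∀ t ∈ Icc (0 : ℝ) 1, x + t • h ∈ Ω) :
    eLpNorm (fun x => w (x + h) - w x) 2 (volume.restrict C) ≤ ENNReal.ofReal (L * ‖h‖) := by
  have hCΩ : C ⊆ Ω := fun x hx => by simpa using hh x hx 0 (by simp)
  have hC' : IsCompact ((fun x => x + h) '' C) := hC.image (by fun_prop)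
  obtain ⟨hfC, hwC, hlim⟩ := hw C hC hCΩ
  obtain ⟨hfC', hwC', hlim'⟩ := hw _ hC' (image_add_right_subset_of_segment hh)
  -- The path keeps a positive distance `ρ` from the complement, so the bound applies as soon as `r
  -- j < ρ`.
  obtain ⟨ρ, hρ, hsub⟩ := hC.exists_pos_closedBall_segment_subset hΩ h hh
  have hev : ∀ᶠ j in atTop, eLpNorm (fun x => w (x + h) - w x) 2 (volume.restrict C) ≤
      eLpNorm (fun x => f j x - w x) 2 (volume.restrict ((fun x => x + h) '' C)) +
        ENNReal.ofReal (L * (‖h‖ + r j)) +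
        eLpNorm (fun x => f j x - w x) 2 (volume.restrict C) := by
    filter_upwards [hf, hr.eventually_lt_const hρ] with j hj hrj
    have h1 := hj C h hC.measurableSet
      (fun x hx t ht => (Metric.closedBall_subset_closedBall hrj.le).trans (hsub x hx t ht))
    have m1 : AEStronglyMeasurable (fun x => w (x + h) - f j (x + h)) (volume.restrict C) :=
      (aestronglyMeasurable_comp_add_right_restrict hwC'.1).sub
        (aestronglyMeasurable_comp_add_right_restrict (hfC' j).1)
    have m2 : AEStronglyMeasurable (fun x => f j (x + h) - f j x) (volume.restrict C) :=
      (aestronglyMeasurable_comp_add_right_restrict (hfC' j).1).sub (hfC j).1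
    have m3 : AEStronglyMeasurable (fun x => f j x - w x) (volume.restrict C) :=
      (hfC j).1.sub hwC.1
    have e1 : eLpNorm (fun x => w (x + h) - f j (x + h)) 2 (volume.restrict C) =
        eLpNorm (fun x => f j x - w x) 2 (volume.restrict ((fun x => x + h) '' C)) := by
      rw [← eLpNorm_comp_add_right_restrict volume (fun x => f j x - w x) 2 C h]
      exact eLpNorm_sub_comm (fun x => w (x + h)) (fun x => f j (x + h)) _ _
    have e2 : (fun x => w (x + h) - w x) =
        ((fun x => w (x + h) - f j (x + h)) + (fun x => f j (x + h) - f j x)) +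
          fun x => f j x - w x := by
      ext x; simp
    rw [e2]
    refine (eLpNorm_add_le (m1.add m2) m3 one_le_two).trans ?_
    gcongr
    refine (eLpNorm_add_le m1 m2 one_le_two).trans ?_
    rw [e1]
    gcongr
  have hL : Tendsto (fun j => ENNReal.ofReal (L * (‖h‖ + r j))) atTop
      (𝓝 (ENNReal.ofReal (L * ‖h‖))) := by
    refine ENNReal.tendsto_ofReal ?_
    simpa using (hr.const_add ‖h‖).const_mul L
  have := ge_of_tendsto ((hlim'.add hL).add hlim) hev
  simpa using this

/-- A function that is locally in `L²` and whose translates along paths in `Ω` move at most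
linearly is in `L²` up to a Lipschitz boundary. -/
theorem memLp_two_of_translate_of_lipschitzBoundary {Ω : Set (EuclideanSpace ℝ (Fin d))}
    (hΩ : IsOpen Ω) (hΩb : Bornology.IsBounded Ω) (hΩl : HasLipschitzBoundary Ω)
    {w : EuclideanSpace ℝ (Fin d) → ℝ} {L : ℝ}
    (hw : ∀ C, IsCompact C → C ⊆ Ω → MemLp w 2 (volume.restrict C))
    (hwt : ∀ C h, IsCompact C → (∀ x ∈ C, ∀ t ∈ Icc (0 : ℝ) 1, x + t • h ∈ Ω) →
      eLpNorm (fun x => w (x + h) - w x) 2 (volume.restrict C) ≤ ENNReal.ofReal (L * ‖h‖)) :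
    MemLp w 2 (volume.restrict Ω) := by
  -- Integrability near the boundary is not known beforehand, so the mass is tested on compact C ⊆ Ω
  -- with a bound uniform in C. Such a bound is local, hence follows from compactness of `closure
  -- Ω`.
  have key : ∃ b : ℝ≥0∞, b < ⊤ ∧ ∀ C, IsCompact C → C ⊆ Ω →
      ∫⁻ x in C ∩ closure Ω, ‖w x‖ₑ ^ 2 ≤ b := by
    refine IsCompact.induction_on (p := fun s => ∃ b : ℝ≥0∞, b < ⊤ ∧ ∀ C, IsCompact C → C ⊆ Ω →
      ∫⁻ x in C ∩ s, ‖w x‖ₑ ^ 2 ≤ b) hΩb.isCompact_closure ?_ ?_ ?_ ?_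
    · exact ⟨0, by simp, by simp⟩
    · rintro s t hst ⟨b, hb, hbC⟩
      exact ⟨b, hb, fun C hC hCΩ =>
        (lintegral_mono_set (inter_subset_inter_right C hst)).trans (hbC C hC hCΩ)⟩
    · rintro s t ⟨b, hb, hbC⟩ ⟨b', hb', hbC'⟩
      refine ⟨b + b', by simp [hb, hb'], fun C hC hCΩ => ?_⟩
      rw [inter_union_distrib_left]
      exact (lintegral_union_le _ _ _).trans (add_le_add (hbC C hC hCΩ) (hbC' C hC hCΩ))
    · intro x hx
      have hcompact : ∀ Z, IsCompact Z → Z ⊆ Ω → ∫⁻ x in Z, ‖w x‖ₑ ^ 2 < ⊤ := by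
        intro Z hZ hZΩ
        rw [← eLpNorm_two_sq]
        exact ENNReal.pow_lt_top (hw Z hZ hZΩ).2
      by_cases hxΩ : x ∈ Ω
      · obtain ⟨ρ, hρ, hsub⟩ := Metric.isOpen_iff.1 hΩ x hxΩ
        have hsub' : Metric.closedBall x (ρ / 2) ⊆ Ω :=
          (Metric.closedBall_subset_ball (by linarith)).trans hsub
        exact ⟨Metric.closedBall x (ρ / 2),
          mem_nhdsWithin_of_mem_nhds (Metric.closedBall_mem_nhds x (by linarith)), _,
          hcompact _ (isCompact_closedBall x _) hsub',
          fun C _ _ => lintegral_mono_set inter_subset_right⟩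
      · have hxf : x ∈ frontier Ω := by
          rw [frontier, hΩ.interior_eq]
          exact ⟨hx, hxΩ⟩
        obtain ⟨r, ν, L', g, hr, hν, hg, hgr⟩ := hΩl x hxf
        -- A point of the `τ`-ball moved by at most `τ` along `ν` stays within r/2 of x, where the
        -- graph description of Ω is valid.
        set τ : ℝ := r / 4 with hτ
        have hτ0 : 0 < τ := by positivity
        have hνν : inner ℝ ν ν = (1 : ℝ) := by
          rw [real_inner_self_eq_norm_sq, hν]; norm_num
        -- Points at height at least `τ` above the graph form a compact subset of Ω, where w is
        -- already known to be in L². Every point of Ω near x is carried into `Z` by the shift `τ •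
        -- ν`.
        set Z : Set (EuclideanSpace ℝ (Fin d)) := Metric.closedBall x (r / 2) ∩
          {z | g (z - inner ℝ z ν • ν) + τ ≤ inner ℝ z ν} with hZ
        have hZc : IsCompact Z := by
          refine (isCompact_closedBall x _).inter_right (isClosed_le ?_ ?_)
          · have := hg.continuous
            fun_prop
          · fun_prop
        have hZΩ : Z ⊆ Ω := by
          rintro z ⟨hz1, hz2⟩
          refine (hgr z (Metric.closedBall_subset_ball (by linarith) hz1)).2 ?_
          simp only [mem_ofPred_eq] at hz2
          linarith
        have hshift : ∀ z : EuclideanSpace ℝ (Fin d), ∀ t : ℝ,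
            (z + t • ν) - inner ℝ (z + t • ν) ν • ν = z - inner ℝ z ν • ν ∧
            inner ℝ (z + t • ν) ν = inner ℝ z ν + t := by
          intro z t
          have h2 : inner ℝ (z + t • ν) ν = inner ℝ z ν + t := by
            rw [inner_add_left, real_inner_smul_left, hνν, mul_one]
          refine ⟨?_, h2⟩
          rw [h2]
          module
        refine ⟨Metric.closedBall x τ,
          mem_nhdsWithin_of_mem_nhds (Metric.closedBall_mem_nhds x hτ0),
          (ENNReal.ofReal (L * ‖τ • ν‖) + eLpNorm w 2 (volume.restrict Z)) ^ 2,
          ENNReal.pow_lt_top (by simpa using (hw Z hZc hZΩ).2), fun C hC hCΩ => ?_⟩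
        rw [← eLpNorm_two_le_iff]
        set C' := C ∩ Metric.closedBall x τ with hC'
        have hC'c : IsCompact C' := hC.inter_right Metric.isClosed_closedBall
        have hball : ∀ z ∈ C', ∀ t ∈ Icc (0 : ℝ) τ, dist (z + t • ν) x ≤ r / 2 := by
          intro z hz t ht
          have h1 : dist z x ≤ τ := hz.2
          have h2 : dist (z + t • ν) z ≤ τ := by
            rw [dist_eq_norm, add_sub_cancel_left, norm_smul, hν, mul_one, Real.norm_eq_abs,
              abs_of_nonneg ht.1]
            exact ht.2
          have := dist_triangle (z + t • ν) z x
          linarith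
        have hzΩ : ∀ z ∈ C', g (z - inner ℝ z ν • ν) < inner ℝ z ν := by
          intro z hz
          exact (hgr z (Metric.closedBall_subset_ball (by linarith) hz.2)).1 (hCΩ hz.1)
        have hseg : ∀ z ∈ C', ∀ t ∈ Icc (0 : ℝ) 1, z + t • τ • ν ∈ Ω := by
          intro z hz t ht
          rw [smul_smul]
          have htτ : t * τ ∈ Icc 0 τ := ⟨mul_nonneg ht.1 hτ0.le, by nlinarith [ht.2]⟩
          have hb := hball z hz _ htτ
          refine (hgr _ (by rw [Metric.mem_ball]; linarith)).2 ?_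
          rw [(hshift z _).1, (hshift z _).2]
          linarith [hzΩ z hz, htτ.1]
        have himg : (fun z => z + τ • ν) '' C' ⊆ Z := by
          rintro _ ⟨z, hz, rfl⟩
          refine ⟨hball z hz τ ⟨hτ0.le, le_rfl⟩, ?_⟩
          simp only [mem_ofPred_eq]
          rw [(hshift z _).1, (hshift z _).2]
          linarith [hzΩ z hz]
        have hwC' := hw C' hC'c (inter_subset_left.trans hCΩ)
        have hwI := (hw Z hZc hZΩ).mono_measure (Measure.restrict_mono_set volume himg)
        have m1 := aestronglyMeasurable_comp_add_right_restrict hwI.1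
        have e2 : w = (fun z => w (z + τ • ν)) - fun z => w (z + τ • ν) - w z := by
          ext z; simp
        calc eLpNorm w 2 (volume.restrict C')
            = eLpNorm ((fun z => w (z + τ • ν)) - fun z => w (z + τ • ν) - w z) 2
                (volume.restrict C') := by rw [← e2]
          _ ≤ eLpNorm (fun z => w (z + τ • ν)) 2 (volume.restrict C') +
                eLpNorm (fun z => w (z + τ • ν) - w z) 2 (volume.restrict C') :=
              eLpNorm_sub_le m1 (m1.sub hwC'.1) one_le_two
          _ ≤ eLpNorm w 2 (volume.restrict Z) + ENNReal.ofReal (L * ‖τ • ν‖) := by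
              rw [eLpNorm_comp_add_right_restrict]
              exact add_le_add (eLpNorm_mono_measure _ (Measure.restrict_mono_set volume himg))
                (hwt C' _ hC'c hseg)
          _ = _ := add_comm _ _
  obtain ⟨b, hb, hbC⟩ := key
  -- An increasing compact exhaustion turns the uniform bound into a bound on Ω by monotone
  -- convergence.
  obtain ⟨F, hFc, hFs, hFu, hFm⟩ := hΩ.exists_iUnion_isClosed
  have hFK : ∀ n, IsCompact (F n) := fun n =>
    Metric.isCompact_of_isClosed_isBounded (hFc n) (hΩb.subset (hFs n))
  have hmeas : AEStronglyMeasurable w (volume.restrict Ω) := by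
    rw [← hFu, aestronglyMeasurable_iUnion_iff]
    exact fun n => (hw _ (hFK n) (hFs n)).1
  refine ⟨hmeas, ?_⟩
  have hle : ∫⁻ x in Ω, ‖w x‖ₑ ^ 2 ≤ b := by
    rw [← hFu, setLIntegral_iUnion_of_directed _ hFm.directed_le]
    refine iSup_le fun n => ?_
    have := hbC (F n) (hFK n) (hFs n)
    rwa [inter_eq_left.2 ((hFs n).trans subset_closure)] at this
  have h2 := lt_of_le_of_lt hle hb
  rw [← eLpNorm_two_sq] at h2
  by_contra hcon
  rw [not_lt, top_le_iff] at hcon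
  simp [hcon] at h2

end Limit

/-! ### Weak derivatives from difference quotients -/

section WeakDerivative

variable {d : ℕ}

/-- A linear functional dominated by the norm of the image under a linear map into a Hilbert space
is represented by a vector of the Hilbert space. -/
theorem exists_inner_eq_of_abs_le {D H : Type*} [AddCommGroup D] [Module ℝ D]
    [NormedAddCommGroup H] [InnerProductSpace ℝ H] [CompleteSpace H]
    (T : D →ₗ[ℝ] H) (l : D →ₗ[ℝ] ℝ) (M : ℝ) (h : ∀ x, |l x| ≤ M * ‖T x‖) :
    ∃ g : H, ∀ x, l x = inner ℝ g (T x) := by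
  -- `D` carries no topology. The functional is moved to the range of `T` by a linear section, where
  -- the hypothesis makes it bounded, and Hahn–Banach extends it to `H`.
  obtain ⟨s, hs⟩ := T.rangeRestrict.exists_rightInverse_of_surjective T.range_rangeRestrict
  have hs' : ∀ y : LinearMap.range T, T (s y) = y := fun y =>
    congrArg Subtype.val (LinearMap.congr_fun hs y)
  let l' : StrongDual ℝ (LinearMap.range T) := (l ∘ₗ s).mkContinuous M (fun y => by
    have := h (s y)
    rw [hs'] at this
    simpa using this)
  obtain ⟨G, hG, -⟩ := exists_extension_norm_eq (LinearMap.range T) l'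
  refine ⟨(InnerProductSpace.toDual ℝ H).symm G, fun x => ?_⟩
  rw [InnerProductSpace.toDual_symm_apply]
  have h1 := hG ⟨T x, LinearMap.mem_range_self T x⟩
  rw [h1]
  -- This vector is in the kernel of `T`, so `l` vanishes on it: the choice of section does not
  -- matter.
  have h2 := h (x - s ⟨T x, LinearMap.mem_range_self T x⟩)
  rw [map_sub, map_sub, hs'] at h2
  simp only [sub_self, norm_zero, mul_zero] at h2
  have h3 := abs_nonpos_iff.1 h2
  simpa [l', sub_eq_zero] using h3

/-- The difference-quotient estimate for the weak directional derivative. -/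
theorem enorm_integral_mul_fderiv_le {Ω : Set (EuclideanSpace ℝ (Fin d))}
    (hΩ : IsOpen Ω) (hΩb : Bornology.IsBounded Ω) {w : EuclideanSpace ℝ (Fin d) → ℝ} {L : ℝ}
    (hw : MemLp w 2 (volume.restrict Ω))
    (hwt : ∀ C h, IsCompact C → (∀ x ∈ C, ∀ t ∈ Icc (0 : ℝ) 1, x + t • h ∈ Ω) →
      eLpNorm (fun x => w (x + h) - w x) 2 (volume.restrict C) ≤ ENNReal.ofReal (L * ‖h‖))
    (v : EuclideanSpace ℝ (Fin d)) {ψ : EuclideanSpace ℝ (Fin d) → ℝ} (hψ : ContDiff ℝ ∞ ψ)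
    (hψc : HasCompactSupport ψ) (hψΩ : tsupport ψ ⊆ Ω) :
    ‖∫ x in Ω, w x * fderiv ℝ ψ x v‖ₑ ≤
      ENNReal.ofReal (L * ‖v‖) * eLpNorm ψ 2 (volume.restrict Ω) := by
  have hΩm := hΩ.measurableSet
  have : IsFiniteMeasure (volume.restrict Ω) := ⟨by simpa using hΩb.measure_lt_top⟩
  set W := Ω.indicator w with hW
  have hWint : Integrable W := (integrable_indicator_iff hΩm).2 (hw.integrable one_le_two)
  have hWL : MemLp W 2 := (memLp_indicator_iff_restrict hΩm).2 hw
  obtain ⟨Kψ, hK⟩ := hψ.lipschitzWith_of_hasCompactSupport hψc (by simp)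
  have hψL : MemLp ψ 2 := hψ.continuous.memLp_of_hasCompactSupport hψc
  have hint : ∫ x in Ω, w x * fderiv ℝ ψ x v = ∫ x, W x * fderiv ℝ ψ x v := by
    rw [← integral_indicator hΩm]
    congr 1; ext x
    by_cases hx : x ∈ Ω <;> simp [W, hx]
  -- The direction is −v so that, after the change of variables, `w` is translated by +tv. The
  -- Lipschitz constant of ψ times |W| dominates.
  have hlim : Tendsto (fun t : ℝ => ∫ x, W x * (t⁻¹ * (ψ (x + t • (-v)) - ψ x))) (𝓝[>] 0)
      (𝓝 (∫ x, W x * fderiv ℝ ψ x (-v))) := by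
    refine tendsto_integral_filter_of_dominated_convergence
      (fun x => (Kψ * ‖v‖) * ‖W x‖) ?_ ?_ (hWint.norm.const_mul _) ?_
    · refine Eventually.of_forall fun t => hWint.aestronglyMeasurable.mul ?_
      have := hψ.continuous
      exact Continuous.aestronglyMeasurable (by fun_prop)
    · filter_upwards [self_mem_nhdsWithin] with t ht
      refine Eventually.of_forall fun x => ?_
      have ht' : 0 < t := ht
      have h1 := hK.dist_le_mul (x + t • (-v)) x
      rw [dist_eq_norm, dist_eq_norm, add_sub_cancel_left, norm_smul, norm_neg,
        Real.norm_of_nonneg ht'.le] at h1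
      rw [norm_mul, norm_mul, norm_inv, Real.norm_of_nonneg ht'.le, mul_comm]
      refine mul_le_mul_of_nonneg_right ?_ (norm_nonneg _)
      rw [inv_mul_le_iff₀ ht']
      linarith
    · refine Eventually.of_forall fun x => ?_
      have hd : HasDerivAt (fun t : ℝ => ψ (x + t • (-v))) (fderiv ℝ ψ x (-v)) 0 := by
        have h1 : HasFDerivAt ψ (fderiv ℝ ψ x) (x + (0 : ℝ) • (-v)) := by
          rw [zero_smul, add_zero]
          exact (hψ.differentiable (by simp) x).hasFDerivAt
        have h2 : HasDerivAt (fun t : ℝ => x + t • (-v)) (-v) 0 := by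
          simpa using ((hasDerivAt_id (0 : ℝ)).smul_const (-v)).const_add x
        exact h1.comp_hasDerivAt _ h2
      have := hd.tendsto_slope_zero_right
      simp only [zero_add, zero_smul, add_zero, smul_eq_mul] at this
      exact this.const_mul _
  have hseg : ∀ x ∈ tsupport ψ, ∀ t ∈ Icc (0 : ℝ) 1, x + t • (0 : EuclideanSpace ℝ (Fin d)) ∈ Ω :=
    fun x hx t _ => by simpa using hψΩ hx
  obtain ⟨ρ, hρ, hsub⟩ := IsCompact.exists_pos_closedBall_segment_subset hψc hΩ _ hseg
  have hbound : ∀ᶠ t : ℝ in 𝓝[>] 0, ‖∫ x, W x * (t⁻¹ * (ψ (x + t • (-v)) - ψ x))‖ₑ ≤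
      ENNReal.ofReal (L * ‖v‖) * eLpNorm ψ 2 (volume.restrict Ω) := by
    have hev : ∀ᶠ t : ℝ in 𝓝[>] 0, t * ‖v‖ < ρ := by
      refine eventually_nhdsWithin_of_eventually_nhds ?_
      have : Tendsto (fun t : ℝ => t * ‖v‖) (𝓝 0) (𝓝 0) := by
        simpa using (tendsto_id (x := 𝓝 (0 : ℝ))).mul_const ‖v‖
      exact this.eventually_lt_const hρ
    filter_upwards [hev, self_mem_nhdsWithin] with t ht ht0
    have ht0 : 0 < t := ht0
    have hi1 : Integrable (fun x => W x * ψ (x + t • (-v))) := by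
      refine hWL.integrable_mul (q := 2) ?_
      exact hψL.comp_measurePreserving (measurePreserving_add_right volume (t • (-v)))
    have hi2 : Integrable (fun x => W x * ψ x) := hWL.integrable_mul hψL
    have hi3 : Integrable (fun x => W (x + t • v) * ψ x) := by
      refine MemLp.integrable_mul (p := 2) (q := 2) ?_ hψL
      exact hWL.comp_measurePreserving (measurePreserving_add_right volume (t • v))
    -- Discrete integration by parts. Since ψ vanishes off its support, and both x and x + tv lie in
    -- Ω for x in the support, the zero extension can be dropped.
    have heq : ∫ x, W x * (t⁻¹ * (ψ (x + t • (-v)) - ψ x)) =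
        t⁻¹ * ∫ x in tsupport ψ, (w (x + t • v) - w x) * ψ x := by
      have e1 : ∫ x, W x * ψ (x + t • (-v)) = ∫ x, W (x + t • v) * ψ x := by
        rw [← integral_add_right_eq_self (μ := volume) (fun x => W x * ψ (x + t • (-v))) (t • v)]
        simp
      have e2 : ∫ x, (W (x + t • v) - W x) * ψ x =
          ∫ x in tsupport ψ, (w (x + t • v) - w x) * ψ x := by
        rw [← integral_indicator (isClosed_tsupport ψ).measurableSet]
        congr 1; ext x
        by_cases hx : x ∈ tsupport ψ
        · have hx1 : x + t • v ∈ Ω := by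
            have h1 := hsub x hx 0 (by simp)
            rw [smul_zero, add_zero] at h1
            apply h1
            rw [mem_closedBall_iff_norm, add_sub_cancel_left, norm_smul,
              Real.norm_of_nonneg ht0.le]
            exact ht.le
          simp [W, hx, hψΩ hx, hx1]
        · simp [hx, image_eq_zero_of_notMem_tsupport hx]
      calc ∫ x, W x * (t⁻¹ * (ψ (x + t • (-v)) - ψ x))
          = t⁻¹ * ∫ x, (W x * ψ (x + t • (-v)) - W x * ψ x) := by
            rw [← integral_const_mul]; congr 1; ext x; ring
        _ = t⁻¹ * ∫ x, (W (x + t • v) - W x) * ψ x := by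
            rw [integral_sub hi1 hi2, e1, ← integral_sub hi3 hi2]
            congr 2; ext x; ring
        _ = _ := by rw [e2]
    rw [heq, enorm_mul]
    have hwm : AEStronglyMeasurable (fun x => w (x + t • v) - w x)
        (volume.restrict (tsupport ψ)) := by
      refine (aestronglyMeasurable_comp_add_right_restrict (hw.1.mono_measure
        (Measure.restrict_mono_set volume ?_))).sub
        (hw.1.mono_measure (Measure.restrict_mono_set volume hψΩ))
      rintro _ ⟨x, hx, rfl⟩
      have h1 := hsub x hx 0 (by simp)
      rw [smul_zero, add_zero] at h1
      apply h1
      simp only [mem_closedBall_iff_norm, add_sub_cancel_left, norm_smul,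
        Real.norm_of_nonneg ht0.le]
      exact ht.le
    have hH : ‖∫ x in tsupport ψ, (w (x + t • v) - w x) * ψ x‖ₑ ≤
        ENNReal.ofReal (L * ‖t • v‖) * eLpNorm ψ 2 (volume.restrict Ω) := by
      refine (enorm_integral_le_lintegral_enorm _).trans ?_
      rw [← eLpNorm_one_eq_lintegral_enorm]
      refine (eLpNorm_smul_le_mul_eLpNorm (p := 2) (q := 2) (r := 1)
        hψL.1.restrict hwm).trans ?_
      refine mul_le_mul' (hwt _ _ hψc ?_)
        (eLpNorm_mono_measure _ (Measure.restrict_mono_set volume hψΩ))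
      intro x hx s hs
      have h1 := hsub x hx 0 (by simp)
      rw [smul_zero, add_zero] at h1
      apply h1
      rw [mem_closedBall_iff_norm, add_sub_cancel_left, norm_smul, norm_smul,
        Real.norm_of_nonneg ht0.le, Real.norm_of_nonneg hs.1]
      nlinarith [hs.2, hs.1, mul_nonneg ht0.le (norm_nonneg v)]
    calc ‖t⁻¹‖ₑ * ‖∫ x in tsupport ψ, (w (x + t • v) - w x) * ψ x‖ₑ
        ≤ ENNReal.ofReal t⁻¹ *
          (ENNReal.ofReal (L * ‖t • v‖) * eLpNorm ψ 2 (volume.restrict Ω)) := by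
          rw [Real.enorm_of_nonneg (inv_nonneg.2 ht0.le)]
          gcongr
      _ = _ := by
          rw [← mul_assoc, ← ENNReal.ofReal_mul (inv_nonneg.2 ht0.le), norm_smul,
            Real.norm_of_nonneg ht0.le]
          congr 2
          field_simp
  have h3 := le_of_tendsto hlim.enorm hbound
  rw [hint]
  simpa [integral_neg] using h3

/-- The difference-quotient estimate makes ψ ↦ ∫ w ∂ᵢψ bounded for the L² norm of ψ. Riesz
represents it by some G, and −G is the weak derivative. -/
theorem memH1_of_translate {Ω : Set (EuclideanSpace ℝ (Fin d))}
    (hΩ : IsOpen Ω) (hΩb : Bornology.IsBounded Ω) {w : EuclideanSpace ℝ (Fin d) → ℝ} {L : ℝ}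
    (hL : 0 ≤ L) (hw : MemLp w 2 (volume.restrict Ω))
    (hwt : ∀ C h, IsCompact C → (∀ x ∈ C, ∀ t ∈ Icc (0 : ℝ) 1, x + t • h ∈ Ω) →
      eLpNorm (fun x => w (x + h) - w x) 2 (volume.restrict C) ≤ ENNReal.ofReal (L * ‖h‖)) :
    MemH1 Ω w := by
  have : IsFiniteMeasure (volume.restrict Ω) := ⟨by simpa using hΩb.measure_lt_top⟩
  let D : Submodule ℝ (EuclideanSpace ℝ (Fin d) → ℝ) :=
    { carrier := {ψ | ContDiff ℝ ∞ ψ ∧ HasCompactSupport ψ ∧ tsupport ψ ⊆ Ω}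
      add_mem' := fun {a b} ha hb => ⟨ha.1.add hb.1, ha.2.1.add hb.2.1,
        (tsupport_add a b).trans (union_subset ha.2.2 hb.2.2)⟩
      zero_mem' := ⟨contDiff_const, HasCompactSupport.zero, by
        rw [show tsupport (0 : EuclideanSpace ℝ (Fin d) → ℝ) = ∅ from tsupport_eq_empty_iff.2 rfl]
        exact empty_subset _⟩
      smul_mem' := fun c a ha => ⟨contDiff_const.smul ha.1, ha.2.1.smul_left,
        (tsupport_smul_subset_right (fun _ => c) a).trans ha.2.2⟩ }
  have hDL : ∀ ψ : D, MemLp (ψ : EuclideanSpace ℝ (Fin d) → ℝ) 2 (volume.restrict Ω) :=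
    fun ψ => (ψ.2.1.continuous.memLp_of_hasCompactSupport ψ.2.2.1).restrict Ω
  let T : D →ₗ[ℝ] Lp ℝ 2 (volume.restrict Ω) :=
    { toFun := fun ψ => (hDL ψ).toLp
      map_add' := fun a b => MemLp.toLp_add (hDL a) (hDL b)
      map_smul' := fun c a => MemLp.toLp_const_smul c (hDL a) }
  refine ⟨hw, ?_⟩
  have hrep : ∀ i : Fin d, ∃ G : Lp ℝ 2 (volume.restrict Ω), ∀ ψ : D,
      ∫ x in Ω, w x * fderiv ℝ (ψ : EuclideanSpace ℝ (Fin d) → ℝ) x (EuclideanSpace.single i 1) =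
        inner ℝ G (T ψ) := by
    intro i
    have hint : ∀ ψ : D, Integrable (fun x => w x *
        fderiv ℝ (ψ : EuclideanSpace ℝ (Fin d) → ℝ) x (EuclideanSpace.single i 1))
        (volume.restrict Ω) := by
      intro ψ
      refine hw.integrable_mul (q := 2) ?_
      have hc : Continuous fun x =>
          fderiv ℝ (ψ : EuclideanSpace ℝ (Fin d) → ℝ) x (EuclideanSpace.single i 1) :=
        (ψ.2.1.continuous_fderiv (by simp)).clm_apply continuous_const
      exact (hc.memLp_of_hasCompactSupport (ψ.2.2.1.fderiv_apply ℝ _)).restrict Ω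
    let l : D →ₗ[ℝ] ℝ :=
      { toFun := fun ψ => ∫ x in Ω, w x *
          fderiv ℝ (ψ : EuclideanSpace ℝ (Fin d) → ℝ) x (EuclideanSpace.single i 1)
        map_add' := fun a b => by
          rw [← integral_add (hint a) (hint b)]
          congr 1; ext x
          have := fderiv_add (a.2.1.differentiable (by simp) x)
            (b.2.1.differentiable (by simp) x)
          rw [Submodule.coe_add, this, _root_.add_apply, mul_add]
        map_smul' := fun c a => by
          rw [RingHom.id_apply, smul_eq_mul, ← integral_const_mul]
          congr 1; ext x
          have := fderiv_const_smul (a.2.1.differentiable (by simp) x) c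
          rw [Submodule.coe_smul, this, _root_.smul_apply, smul_eq_mul]
          ring }
    refine exists_inner_eq_of_abs_le T l (L * ‖(EuclideanSpace.single i 1 :
      EuclideanSpace ℝ (Fin d))‖) fun ψ => ?_
    have h1 := enorm_integral_mul_fderiv_le hΩ hΩb hw hwt (EuclideanSpace.single i 1)
      ψ.2.1 ψ.2.2.1 ψ.2.2.2
    have h2 := ENNReal.toReal_mono (ENNReal.mul_ne_top ENNReal.ofReal_ne_top (hDL ψ).2.ne) h1
    rw [ENNReal.toReal_mul, ENNReal.toReal_ofReal (by positivity), toReal_enorm,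
      Real.norm_eq_abs] at h2
    have h3 : ‖T ψ‖ = _ := Lp.norm_toLp _ (hDL ψ)
    rw [h3]
    exact h2
  choose G hG using hrep
  refine ⟨fun i => -(G i), fun i => ⟨(Lp.memLp (G i)).neg, fun ψ h1 h2 h3 => ?_⟩⟩
  have h4 := hG i ⟨ψ, h1, h2, h3⟩
  simp only at h4
  rw [h4, L2.inner_def, ← integral_neg]
  refine integral_congr_ae ?_
  filter_upwards [(hDL ⟨ψ, h1, h2, h3⟩).coeFn_toLp] with x hx
  simp only [T, LinearMap.coe_mk, AddHom.coe_mk, hx]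
  simp [mul_comm]

/-- Limits in `L²_loc` of functions with uniform translation bounds are in `H¹`. -/
theorem TendstoL2Loc.memH1 {Ω : Set (EuclideanSpace ℝ (Fin d))}
    (hΩ : IsOpen Ω) (hΩb : Bornology.IsBounded Ω) (hΩl : HasLipschitzBoundary Ω)
    {f : ℕ → EuclideanSpace ℝ (Fin d) → ℝ} {w : EuclideanSpace ℝ (Fin d) → ℝ}
    {r : ℕ → ℝ} {L : ℝ} (hL : 0 ≤ L) (hr : Tendsto r atTop (𝓝 0))
    (hf : ∀ᶠ j in atTop, TranslationBound Ω (r j) L (f j)) (hw : TendstoL2Loc Ω f w) :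
    MemH1 Ω w := by
  have hwt : ∀ C h, IsCompact C → (∀ x ∈ C, ∀ t ∈ Icc (0 : ℝ) 1, x + t • h ∈ Ω) →
      eLpNorm (fun x => w (x + h) - w x) 2 (volume.restrict C) ≤ ENNReal.ofReal (L * ‖h‖) :=
    fun C h hC hh => hw.eLpNorm_translate_sub_le hΩ hr hf hC hh
  exact memH1_of_translate hΩ hΩb hL (memLp_two_of_translate_of_lipschitzBoundary hΩ hΩb hΩl
    (fun C hC hCΩ => (hw C hC hCΩ).2.1) hwt) hwt

end WeakDerivative

/-! ### Lattice cells and averages over them -/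

section Cells

variable {d : ℕ}

/-- The crude factor d in place of √d keeps square roots out of the later radii. -/
theorem EuclideanSpace.norm_le_of_forall_abs_le {x : EuclideanSpace ℝ (Fin d)} {b : ℝ}
    (hx : ∀ i, |x i| ≤ b) : ‖x‖ ≤ d * b := by
  rcases Nat.eq_zero_or_pos d with rfl | hd
  · simp [EuclideanSpace.norm_eq]
  have hb : 0 ≤ b := (abs_nonneg _).trans (hx ⟨0, hd⟩)
  have hd1 : (1 : ℝ) ≤ d := by exact_mod_cast hd
  rw [EuclideanSpace.norm_eq, Real.sqrt_le_left (by positivity)]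
  calc ∑ i, ‖x i‖ ^ 2 ≤ ∑ _i : Fin d, b ^ 2 := by
        gcongr with i
        exact hx i
    _ = d * b ^ 2 := by simp
    _ ≤ (d * b) ^ 2 := by nlinarith [sq_nonneg b]

theorem EuclideanSpace.abs_apply_le_norm (x : EuclideanSpace ℝ (Fin d)) (i : Fin d) :
    |x i| ≤ ‖x‖ := PiLp.norm_apply_le x i

/-- The index of the half-open lattice cell of side `η` that contains `x`. -/
noncomputable def cellIndex (η : ℝ) (x : EuclideanSpace ℝ (Fin d)) : Fin d → ℤ :=
  fun i => ⌊x i / η⌋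

/-- The half-open lattice cell of side `η` and index `k`. -/
def cell (η : ℝ) (k : Fin d → ℤ) : Set (EuclideanSpace ℝ (Fin d)) :=
  {x | cellIndex η x = k}

theorem measurable_cellIndex (η : ℝ) : Measurable (cellIndex (d := d) η) := by
  unfold cellIndex
  fun_prop

/-- The centre of a lattice cell. -/
noncomputable def cellCenter (η : ℝ) (k : Fin d → ℤ) : EuclideanSpace ℝ (Fin d) :=
  WithLp.toLp 2 (fun i => η * (k i + 1 / 2))

theorem cell_eq_setOf {η : ℝ} (hη : 0 < η) (k : Fin d → ℤ) :
    cell η k = {x | ∀ i, η * k i ≤ x i ∧ x i < η * (k i + 1)} := by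
  ext x
  simp only [cell, cellIndex, mem_ofPred_eq, funext_iff, Int.floor_eq_iff]
  refine forall_congr' fun i => ?_
  rw [le_div_iff₀ hη, div_lt_iff₀ hη, mul_comm, mul_comm ((k i : ℝ) + 1)]

theorem ball_cellCenter_subset {η : ℝ} (hη : 0 < η) (k : Fin d → ℤ) :
    Metric.ball (cellCenter η k) (η / 2) ⊆ cell η k := by
  intro x hx
  rw [cell_eq_setOf hη]
  intro i
  have h1 := (EuclideanSpace.abs_apply_le_norm (x - cellCenter η k) i).trans_lt
    (mem_ball_iff_norm.1 hx)
  rw [PiLp.sub_apply, abs_lt] at h1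
  simp only [cellCenter] at h1
  constructor <;> nlinarith [h1.1, h1.2]

theorem cell_subset_closedBall {η : ℝ} (hη : 0 < η) (x : EuclideanSpace ℝ (Fin d)) :
    cell η (cellIndex η x) ⊆ Metric.closedBall x (d * η) := by
  intro y hy
  rw [mem_closedBall_iff_norm]
  refine EuclideanSpace.norm_le_of_forall_abs_le fun i => ?_
  have hx : x ∈ cell η (cellIndex η x) := rfl
  rw [cell_eq_setOf hη] at hx hy
  rw [PiLp.sub_apply, abs_le]
  constructor <;> nlinarith [(hx i).1, (hx i).2, (hy i).1, (hy i).2]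

theorem finite_image_cellIndex {η : ℝ} (hη : 0 < η) {C : Set (EuclideanSpace ℝ (Fin d))}
    (hC : Bornology.IsBounded C) : (cellIndex η '' C).Finite := by
  obtain ⟨M, hM⟩ := hC.exists_norm_le
  refine (Set.finite_Icc (fun _ : Fin d => ⌊-M / η⌋) (fun _ => ⌊M / η⌋)).subset ?_
  rintro _ ⟨x, hx, rfl⟩
  have h1 := fun i => abs_le.1 ((EuclideanSpace.abs_apply_le_norm x i).trans (hM x hx))
  exact ⟨fun i => Int.floor_le_floor (div_le_div_of_nonneg_right (h1 i).1 hη.le),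
    fun i => Int.floor_le_floor (div_le_div_of_nonneg_right (h1 i).2 hη.le)⟩

theorem volume_closedBall_mul (x y : EuclideanSpace ℝ (Fin d)) {a s : ℝ} (ha : 0 ≤ a)
    (hs : 0 < s) : volume (Metric.closedBall x (a * s)) =
      ENNReal.ofReal (a ^ d) * volume (Metric.ball y s) := by
  rw [Measure.addHaar_closedBall _ _ (by positivity), Measure.addHaar_ball_of_pos _ _ hs,
    finrank_euclideanSpace_fin, mul_pow, ENNReal.ofReal_mul (by positivity), mul_assoc]

/-- Jensen's inequality divides by the volume of a small ball and Tonelli's theorem multiplies by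
that of a larger one. Only the ratio of the radii survives, so the constants do not depend on the
scale. -/
theorem volume_closedBall_div_le (x y : EuclideanSpace ℝ (Fin d)) {a s : ℝ} (ha : 0 ≤ a)
    (hs : 0 < s) (B : ℝ≥0∞) :
    (volume (Metric.ball y s))⁻¹ * (volume (Metric.closedBall x (a * s)) * B) =
      ENNReal.ofReal (a ^ d) * B := by
  have h0 : volume (Metric.ball y s) ≠ 0 := (Metric.measure_ball_pos volume y hs).ne'
  have h1 : volume (Metric.ball y s) ≠ ⊤ := measure_ball_lt_top.ne
  rw [volume_closedBall_mul x y ha hs, ← mul_assoc, mul_left_comm, ENNReal.inv_mul_cancel h0 h1,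
    mul_one]

/-- The cell averages of `f` are close to `f` when `f` satisfies a translation bound. -/
theorem TranslationBound.eLpNorm_cellAverage_sub_le {Ω : Set (EuclideanSpace ℝ (Fin d))}
    {r L : ℝ} (hL : 0 ≤ L) {f : EuclideanSpace ℝ (Fin d) → ℝ}
    (hf : TranslationBound Ω r L f) (hr : 0 ≤ r) (hfm : Measurable f)
    (hfi : LocallyIntegrable f) {C : Set (EuclideanSpace ℝ (Fin d))} (hC : MeasurableSet C)
    {η : ℝ} (hη : 0 < η) (hCΩ : ∀ x ∈ C, Metric.closedBall x (d * η + r) ⊆ Ω) :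
    eLpNorm (fun x => (⨍ y in cell η (cellIndex η x), f y) - f x) 2 (volume.restrict C) ≤
      ENNReal.ofReal (((2 * d : ℝ) ^ d + 1) * (L * (d * η + r))) := by
  rw [eLpNorm_two_le_iff]
  have hη2 : 0 < η / 2 := by positivity
  refine (lintegral_enorm_sq_setAverage_sub_le volume hfm hC
    (S := fun x => cell η (cellIndex η x)) (R := d * η)
    (c := volume (Metric.ball (0 : EuclideanSpace ℝ (Fin d)) (η / 2)))
    (B := ENNReal.ofReal (L * (d * η + r)) ^ 2)
    (Metric.measure_ball_pos _ _ hη2).ne' ?_ ?_ ?_ ?_ ?_).trans ?_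
  · exact fun x _ => cell_subset_closedBall hη x
  · intro x _
    rw [← Measure.addHaar_ball_center volume (cellCenter η (cellIndex η x))]
    exact measure_mono (ball_cellCenter_subset hη _)
  · exact fun x _ => ((measure_mono (cell_subset_closedBall hη x)).trans_lt
      measure_closedBall_lt_top).ne
  · exact fun x _ => (hfi.integrableOn_isCompact (isCompact_closedBall x (d * η))).mono_set
      (cell_subset_closedBall hη x)
  · intro h hh
    rw [mem_closedBall_zero_iff] at hh
    rw [← eLpNorm_two_le_iff]
    refine (hf C h hC fun x hx t ht => ?_).trans (ENNReal.ofReal_le_ofReal (by gcongr))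
    refine subset_trans (Metric.closedBall_subset_closedBall' ?_) (hCΩ x hx)
    rw [dist_eq_norm, add_sub_cancel_left, norm_smul, Real.norm_of_nonneg ht.1]
    nlinarith [ht.2, norm_nonneg h]
  -- A cell contains a ball of radius η/2 and lies in a ball of radius dη about each of its points,
  -- whence the factor (2d)^d.
  · rw [show (d * η : ℝ) = (2 * d) * (η / 2) by ring,
      volume_closedBall_div_le _ _ (by positivity) hη2, ← ENNReal.ofReal_pow (by positivity),
      ← ENNReal.ofReal_pow (by positivity), ← ENNReal.ofReal_mul (by positivity),
      mul_pow ((2 * d : ℝ) ^ d + 1)]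
    have h1 : (0 : ℝ) ≤ (2 * d) ^ d := by positivity
    exact ENNReal.ofReal_le_ofReal (mul_le_mul_of_nonneg_right (by nlinarith) (sq_nonneg _))

end Cells

/-! ### Propagation of L² bounds, and completeness of L²_loc -/

section Compactness

variable {d : ℕ}

/-- On a ball well inside `Ω`, a function with a translation bound is close to its average. -/
theorem TranslationBound.lintegral_sub_setAverage_closedBall_le
    {Ω : Set (EuclideanSpace ℝ (Fin d))} {r L R : ℝ} (hL : 0 ≤ L)
    {f : EuclideanSpace ℝ (Fin d) → ℝ} (hf : TranslationBound Ω r L f) (hR : 0 < R) (hrR : r ≤ R)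
    (hfm : Measurable f) (hfi : LocallyIntegrable f) {x₀ : EuclideanSpace ℝ (Fin d)}
    (hx₀ : Metric.closedBall x₀ (4 * R) ⊆ Ω) :
    ∫⁻ x in Metric.closedBall x₀ R, ‖f x - ⨍ y in Metric.closedBall x₀ R, f y‖ₑ ^ 2 ≤
      (volume (Metric.closedBall x₀ R))⁻¹ *
        (volume (Metric.closedBall (0 : EuclideanSpace ℝ (Fin d)) (2 * R)) *
          ENNReal.ofReal (L * (2 * R + R)) ^ 2) := by
  have h := lintegral_enorm_sq_setAverage_sub_le volume hfm
    (Metric.isClosed_closedBall (x := x₀) (ε := R)).measurableSet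
    (S := fun _ => Metric.closedBall x₀ R) (R := 2 * R)
    (c := volume (Metric.closedBall x₀ R)) (B := ENNReal.ofReal (L * (2 * R + R)) ^ 2)
    (Metric.measure_closedBall_pos _ _ hR).ne' ?_ (fun _ _ => le_rfl)
    (fun _ _ => measure_closedBall_lt_top.ne)
    (fun _ _ => hfi.integrableOn_isCompact (isCompact_closedBall _ _)) ?_
  · refine le_trans (le_of_eq ?_) h
    congr 1; ext x
    rw [← enorm_neg, neg_sub]
  · intro x hx
    refine Metric.closedBall_subset_closedBall' ?_
    have : dist x₀ x ≤ R := by rw [dist_comm]; exact hx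
    linarith
  · intro h hh
    rw [mem_closedBall_zero_iff] at hh
    rw [← eLpNorm_two_le_iff]
    refine (hf _ h Metric.isClosed_closedBall.measurableSet fun x hx t ht => ?_).trans
      (ENNReal.ofReal_le_ofReal (by gcongr))
    refine subset_trans (Metric.closedBall_subset_closedBall' ?_) hx₀
    have h1 : dist (x + t • h) x ≤ 2 * R := by
      rw [dist_eq_norm, add_sub_cancel_left, norm_smul, Real.norm_of_nonneg ht.1]
      nlinarith [ht.2, norm_nonneg h]
    have h2 : dist x x₀ ≤ R := hx
    have := dist_triangle (x + t • h) x x₀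
    linarith

/-- Translation bounds propagate `L²` bounds from one ball to all compact subsets of a connected
open set. -/
theorem exists_eventually_lintegral_le_of_translationBound {Ω : Set (EuclideanSpace ℝ (Fin d))}
    (hΩ : IsOpen Ω) (hΩc : IsPreconnected Ω) {f : ℕ → EuclideanSpace ℝ (Fin d) → ℝ}
    {r : ℕ → ℝ} {L : ℝ} (hL : 0 ≤ L) (hr : Tendsto r atTop (𝓝 0)) (hfm : ∀ j, Measurable (f j))
    (hf : ∀ᶠ j in atTop, TranslationBound Ω (r j) L (f j))
    {x₀ : EuclideanSpace ℝ (Fin d)} (hx₀ : x₀ ∈ Ω) {R : ℝ} (hR : 0 < R)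
    (hb : ∃ b : ℝ≥0∞, b < ⊤ ∧ ∀ᶠ j in atTop, ∫⁻ x in Metric.ball x₀ R, ‖f j x‖ₑ ^ 2 ≤ b)
    {C : Set (EuclideanSpace ℝ (Fin d))} (hC : IsCompact C) (hCΩ : C ⊆ Ω) :
    ∃ b : ℝ≥0∞, b < ⊤ ∧ ∀ᶠ j in atTop, ∫⁻ x in C, ‖f j x‖ₑ ^ 2 ≤ b := by
  set q : Set (EuclideanSpace ℝ (Fin d)) → Prop := fun s =>
    ∃ b : ℝ≥0∞, b < ⊤ ∧ ∀ᶠ j in atTop, ∫⁻ x in s, ‖f j x‖ₑ ^ 2 ≤ b with hq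
  have hmono : ∀ s t, s ⊆ t → q t → q s := by
    rintro s t hst ⟨b, hb, h⟩
    exact ⟨b, hb, h.mono fun j hj => (lintegral_mono_set hst).trans hj⟩
  set u : Set (EuclideanSpace ℝ (Fin d)) := {x | ∃ ρ > 0, q (Metric.ball x ρ)} with hu
  have huo : IsOpen u := by
    rw [Metric.isOpen_iff]
    rintro x ⟨ρ, hρ, hx⟩
    refine ⟨ρ, hρ, fun y hy => ⟨ρ - dist y x, by simpa using hy, hmono _ _ ?_ hx⟩⟩
    exact Metric.ball_subset_ball' (by linarith)
  have hΩu : Ω ⊆ u := by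
    -- The points with a bounded neighbourhood form an open set meeting Ω. By connectedness it
    -- suffices that this set is closed relative to Ω.
    refine hΩc.subset_of_closure_inter_subset huo ⟨x₀, hx₀, R, hR, hb⟩ ?_
    rintro x ⟨hxu, hxΩ⟩
    obtain ⟨ρ, hρ, hsub⟩ := Metric.isOpen_iff.1 hΩ x hxΩ
    -- The radius `τ`, the shift `h` and the scale `r j` each cost at most `σ`, so everything stays
    -- within ρ of x.
    set σ := ρ / 4 with hσ
    have hσ0 : 0 < σ := by positivity
    obtain ⟨x', ⟨ρ', hρ', b, hb, hx'⟩, hxx'⟩ := Metric.mem_closure_iff.1 hxu σ hσ0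
    set τ := min ρ' σ with hτ
    have hτ0 : 0 < τ := lt_min hρ' hσ0
    refine ⟨τ, hτ0, 2 * ENNReal.ofReal (L * (σ + σ)) ^ 2 + 2 * b,
      ENNReal.add_lt_top.2 ⟨ENNReal.mul_lt_top (by simp)
        (ENNReal.pow_lt_top ENNReal.ofReal_lt_top), ENNReal.mul_lt_top (by simp) hb⟩, ?_⟩
    filter_upwards [hf, hx', hr.eventually_le_const hσ0] with j hj hj' hrj
    set h := x' - x with hh
    have hnh : ‖h‖ ≤ σ := by rw [hh, ← dist_eq_norm, dist_comm]; exact hxx'.le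
    have h1 : ∫⁻ y in Metric.ball x τ, ‖f j (y + h) - f j y‖ₑ ^ 2 ≤
        ENNReal.ofReal (L * (σ + σ)) ^ 2 := by
      rw [← eLpNorm_two_le_iff]
      refine (hj _ h Metric.isOpen_ball.measurableSet fun y hy t ht => ?_).trans
        (ENNReal.ofReal_le_ofReal (by gcongr))
      refine subset_trans (fun z hz => ?_) hsub
      rw [Metric.mem_ball] at hy ⊢
      rw [Metric.mem_closedBall] at hz
      have h2 : dist (y + t • h) y ≤ σ := by
        rw [dist_eq_norm, add_sub_cancel_left, norm_smul, Real.norm_of_nonneg ht.1]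
        nlinarith [ht.2, norm_nonneg h]
      have h3 := dist_triangle z (y + t • h) x
      have h4 := dist_triangle (y + t • h) y x
      have h5 : τ ≤ σ := min_le_right _ _
      linarith
    have h2 : ∫⁻ y in Metric.ball x τ, ‖f j (y + h)‖ₑ ^ 2 ≤ b := by
      have e := eLpNorm_comp_add_right_restrict volume (f j) 2 (Metric.ball x τ) h
      rw [← eLpNorm_two_sq, e, eLpNorm_two_sq]
      refine (lintegral_mono_set ?_).trans hj'
      rintro _ ⟨y, hy, rfl⟩
      rw [Metric.mem_ball, dist_eq_norm] at hy ⊢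
      rw [show y + h - x' = y - x by rw [hh]; abel]
      exact hy.trans_le (min_le_left _ _)
    have hfj := hfm j
    calc ∫⁻ y in Metric.ball x τ, ‖f j y‖ₑ ^ 2
        ≤ ∫⁻ y in Metric.ball x τ,
            (2 * ‖f j (y + h) - f j y‖ₑ ^ 2 + 2 * ‖f j (y + h)‖ₑ ^ 2) := by
          refine lintegral_mono fun y => ?_
          have := enorm_sub_sq_le (f j y) (f j (y + h)) 0
          simp only [sub_zero] at this
          rwa [← enorm_neg (f j y - f j (y + h)), neg_sub] at this
      _ = (2 * ∫⁻ y in Metric.ball x τ, ‖f j (y + h) - f j y‖ₑ ^ 2) +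
            2 * ∫⁻ y in Metric.ball x τ, ‖f j (y + h)‖ₑ ^ 2 := by
          rw [lintegral_add_left (by fun_prop), lintegral_const_mul _ (by fun_prop),
            lintegral_const_mul _ (by fun_prop)]
      _ ≤ _ := by gcongr
  refine IsCompact.induction_on (p := q) hC ?_ hmono ?_ ?_
  · exact ⟨0, by simp, by simp⟩
  · rintro s t ⟨b, hb, h⟩ ⟨b', hb', h'⟩
    refine ⟨b + b', by simp [hb, hb'], ?_⟩
    filter_upwards [h, h'] with j hj hj'
    exact (lintegral_union_le _ _ _).trans (add_le_add hj hj')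
  · intro x hx
    obtain ⟨ρ, hρ, h⟩ := hΩu (hCΩ hx)
    exact ⟨_, mem_nhdsWithin_of_mem_nhds (Metric.ball_mem_nhds x hρ), h⟩

/-- A sequence that is Cauchy in `L²(C)` for all compact `C ⊆ Ω` converges in `L²_loc(Ω)`. -/
theorem exists_tendstoL2Loc_of_cauchy {Ω : Set (EuclideanSpace ℝ (Fin d))}
    (hΩ : IsOpen Ω) (hΩb : Bornology.IsBounded Ω) {f : ℕ → EuclideanSpace ℝ (Fin d) → ℝ}
    (hfL : ∀ j C, IsCompact C → MemLp (f j) 2 (volume.restrict C))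
    (hf : ∀ C, IsCompact C → C ⊆ Ω → ∀ e : ℝ, 0 < e → ∃ N, ∀ i ≥ N, ∀ l ≥ N,
      eLpNorm (fun x => f i x - f l x) 2 (volume.restrict C) ≤ ENNReal.ofReal e) :
    ∃ w, TendstoL2Loc Ω f w := by
  classical
  have hlim : ∀ C, IsCompact C → C ⊆ Ω → ∃ w, MemLp w 2 (volume.restrict C) ∧
      Tendsto (fun j => eLpNorm (fun x => f j x - w x) 2 (volume.restrict C)) atTop (𝓝 0) := by
    intro C hC hCΩ
    have hcs : CauchySeq (fun j => (hfL j C hC).toLp) := by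
      rw [Metric.cauchySeq_iff]
      intro e he
      obtain ⟨N, hN⟩ := hf C hC hCΩ (e / 2) (by positivity)
      refine ⟨N, fun m hm n hn => ?_⟩
      rw [dist_edist, Lp.edist_toLp_toLp]
      refine lt_of_le_of_lt (ENNReal.toReal_mono ENNReal.ofReal_ne_top (hN m hm n hn)) ?_
      rw [ENNReal.toReal_ofReal (by positivity)]
      linarith
    obtain ⟨g, hg⟩ := cauchySeq_tendsto_of_complete hcs
    refine ⟨g, Lp.memLp g, ?_⟩
    have h1 := (Lp.tendsto_Lp_iff_tendsto_eLpNorm'' (fun j => f j) (fun j => hfL j C hC) g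
      (Lp.memLp g)).1 (by simpa using hg)
    exact h1
  obtain ⟨F, hFc, hFs, hFu, -⟩ := hΩ.exists_iUnion_isClosed
  have hFK : ∀ n, IsCompact (F n) := fun n =>
    Metric.isCompact_of_isClosed_isBounded (hFc n) (hΩb.subset (hFs n))
  choose wF hwF hwlim using fun n => hlim (F n) (hFK n) (hFs n)
  -- The limits on the sets `F n` are glued by taking the first `F n` that contains the point. They
  -- agree almost everywhere on overlaps by uniqueness of L² limits.
  refine ⟨fun x => if h : ∃ n, x ∈ F n then wF (Nat.find h) x else 0, fun C hC hCΩ => ?_⟩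
  obtain ⟨w, hw, hwl⟩ := hlim C hC hCΩ
  have hae : ∀ n, ∀ᵐ x ∂volume.restrict C, x ∈ F n → wF n x = w x := by
    intro n
    rw [← ae_restrict_iff' (hFK n).measurableSet, Measure.restrict_restrict (hFK n).measurableSet]
    have hle1 : volume.restrict (F n ∩ C) ≤ volume.restrict (F n) :=
      Measure.restrict_mono_set volume inter_subset_left
    have hle2 : volume.restrict (F n ∩ C) ≤ volume.restrict C :=
      Measure.restrict_mono_set volume inter_subset_right
    have hz : eLpNorm (wF n - w) 2 (volume.restrict (F n ∩ C)) = 0 := by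
      refine le_antisymm ?_ bot_le
      refine ge_of_tendsto (f := fun j =>
        eLpNorm (fun x => f j x - wF n x) 2 (volume.restrict (F n)) +
        eLpNorm (fun x => f j x - w x) 2 (volume.restrict C))
        (by simpa using (hwlim n).add hwl) (Eventually.of_forall fun j => ?_)
      have e : wF n - w = (fun x => f j x - w x) - fun x => f j x - wF n x := by
        ext x; simp
      rw [e, add_comm]
      refine (eLpNorm_sub_le (((hfL j C hC).sub hw).1.mono_measure hle2)
        (((hfL j _ (hFK n)).sub (hwF n)).1.mono_measure hle1) one_le_two).trans ?_
      exact add_le_add (eLpNorm_mono_measure _ hle2) (eLpNorm_mono_measure _ hle1)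
    rw [eLpNorm_eq_zero_iff (((hwF n).1.mono_measure hle1).sub (hw.1.mono_measure hle2))
      two_ne_zero] at hz
    filter_upwards [hz] with x hx
    simpa [sub_eq_zero] using hx
  have hcongr : (fun x => if h : ∃ n, x ∈ F n then wF (Nat.find h) x else 0)
      =ᵐ[volume.restrict C] w := by
    filter_upwards [ae_all_iff.2 hae, ae_restrict_mem hC.measurableSet] with x hx hxC
    have h : ∃ n, x ∈ F n := by
      have := hCΩ hxC
      rwa [← hFu, mem_iUnion] at this
    rw [dif_pos h]
    exact hx _ (Nat.find_spec h)
  refine ⟨fun j => hfL j C hC, (memLp_congr_ae hcongr).2 hw, ?_⟩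
  refine hwl.congr fun j => eLpNorm_congr_ae ?_
  filter_upwards [hcongr] with x hx
  rw [hx]

end Compactness

/-! ### Extraction of a convergent subsequence -/

section Subsequence

variable {d : ℕ}

/-- Rellich-type compactness: a sequence with uniform translation bounds on a connected open set
has, up to additive constants, a subsequence that converges in `L²_loc`. -/
theorem exists_subseq_tendstoL2Loc {Ω : Set (EuclideanSpace ℝ (Fin d))}
    (hΩ : IsOpen Ω) (hΩc : IsConnected Ω) (hΩb : Bornology.IsBounded Ω)
    {f : ℕ → EuclideanSpace ℝ (Fin d) → ℝ} {r : ℕ → ℝ} {L : ℝ} (hL : 0 ≤ L)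
    (hr0 : ∀ j, 0 ≤ r j) (hr : Tendsto r atTop (𝓝 0)) (hfm : ∀ j, Measurable (f j))
    (hfL : ∀ j C, IsCompact C → MemLp (f j) 2 (volume.restrict C))
    (hf : ∀ᶠ j in atTop, TranslationBound Ω (r j) L (f j)) :
    ∃ (s : ℕ → ℕ) (c : ℕ → ℝ) (w : EuclideanSpace ℝ (Fin d) → ℝ), StrictMono s ∧
      TendstoL2Loc Ω (fun j x => f (s j) x + c j) w := by
  classical
  have hint : ∀ {g : EuclideanSpace ℝ (Fin d) → ℝ},
      (∀ C, IsCompact C → MemLp g 2 (volume.restrict C)) → LocallyIntegrable g := by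
    intro g hg
    rw [locallyIntegrable_iff]
    intro C hC
    have : IsFiniteMeasure (volume.restrict C) := ⟨by simpa using hC.measure_lt_top⟩
    exact (hg C hC).integrable one_le_two
  obtain ⟨x₀, hx₀⟩ := hΩc.nonempty
  obtain ⟨ρ₀, hρ₀, hsub₀⟩ := Metric.isOpen_iff.1 hΩ x₀ hx₀
  set R := ρ₀ / 5 with hR
  have hR0 : 0 < R := by positivity
  have hxR : Metric.closedBall x₀ (4 * R) ⊆ Ω :=
    (Metric.closedBall_subset_ball (by rw [hR]; linarith)).trans hsub₀
  set c : ℕ → ℝ := fun j => -⨍ y in Metric.closedBall x₀ R, f j y with hc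
  set F : ℕ → EuclideanSpace ℝ (Fin d) → ℝ := fun j x => f j x + c j with hF
  have hFm : ∀ j, Measurable (F j) := fun j => (hfm j).add_const _
  have hFL : ∀ j C, IsCompact C → MemLp (F j) 2 (volume.restrict C) := by
    intro j C hC
    have : IsFiniteMeasure (volume.restrict C) := ⟨by simpa using hC.measure_lt_top⟩
    exact (hfL j C hC).add (memLp_const _)
  have hFi : ∀ j, LocallyIntegrable (F j) := fun j => hint (hFL j)
  have hFT : ∀ᶠ j in atTop, TranslationBound Ω (r j) L (F j) :=
    hf.mono fun j hj => hj.add_const _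
  have hbd : ∀ C, IsCompact C → C ⊆ Ω →
      ∃ b : ℝ≥0∞, b < ⊤ ∧ ∀ᶠ j in atTop, ∫⁻ x in C, ‖F j x‖ₑ ^ 2 ≤ b := by
    intro C hC hCΩ
    refine exists_eventually_lintegral_le_of_translationBound hΩ hΩc.isPreconnected hL hr hFm hFT
      hx₀ hR0 ⟨(volume (Metric.closedBall x₀ R))⁻¹ *
        (volume (Metric.closedBall (0 : EuclideanSpace ℝ (Fin d)) (2 * R)) *
          ENNReal.ofReal (L * (2 * R + R)) ^ 2), ?_, ?_⟩ hC hCΩ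
    · refine ENNReal.mul_lt_top ?_ (ENNReal.mul_lt_top measure_closedBall_lt_top
        (ENNReal.pow_lt_top ENNReal.ofReal_lt_top))
      exact ENNReal.inv_lt_top.2 (Metric.measure_closedBall_pos _ _ hR0)
    · filter_upwards [hf, hr.eventually_le_const hR0] with j hj hrj
      refine (lintegral_mono_set Metric.ball_subset_closedBall).trans ?_
      exact hj.lintegral_sub_setAverage_closedBall_le hL hR0 hrj (hfm j) (hint (hfL j)) hxR
  set η : ℕ → ℝ := fun n => (1 / 2) ^ n with hη
  have hη0 : ∀ n, 0 < η n := fun n => by positivity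
  have hcellb : ∀ n k, Bornology.IsBounded (cell (d := d) (η n) k) := by
    intro n k
    rcases (cell (d := d) (η n) k).eq_empty_or_nonempty with h | ⟨x, hx⟩
    · rw [h]; exact Bornology.isBounded_empty
    · have hx' : cellIndex (η n) x = k := hx
      rw [← hx']
      exact Metric.isBounded_closedBall.subset (cell_subset_closedBall (hη0 n) x)
  have hcell0 : ∀ n k, volume (cell (d := d) (η n) k) ≠ 0 := fun n k =>
    ((Metric.measure_ball_pos volume (cellCenter (η n) k) (half_pos (hη0 n))).trans_le
      (measure_mono (ball_cellCenter_subset (hη0 n) k))).ne'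
  -- All cell averages at all scales, as one point of a countable product. Cells not well inside Ω
  -- get 0, since no bound is available there.
  set a : ℕ → ℕ × (Fin d → ℤ) → ℝ := fun j p =>
    if closure (cell (η p.1) p.2) ⊆ Ω then ⨍ y in cell (η p.1) p.2, F j y else 0 with ha
  have habd : ∀ p, ∃ B, ∀ j, |a j p| ≤ B := by
    rintro ⟨n, k⟩
    by_cases hcl : closure (cell (η n) k) ⊆ Ω
    · have hcc : IsCompact (closure (cell (d := d) (η n) k)) := (hcellb n k).isCompact_closure
      obtain ⟨b, hb, hj⟩ := hbd _ hcc hcl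
      have hev : ∀ᶠ j in atTop, |a j (n, k)| ≤
          ((volume (cell (d := d) (η n) k))⁻¹ * b).toReal + 1 := by
        filter_upwards [hj] with j hj
        have h1 := enorm_sq_setAverage_sub_le (hcell0 n k) (hcellb n k).measure_lt_top.ne
          (((hFi j).integrableOn_isCompact hcc).mono_set subset_closure) 0
        simp only [sub_zero] at h1
        have h2 := h1.trans (mul_le_mul_right ((lintegral_mono_set subset_closure).trans hj) _)
        have h3 := ENNReal.toReal_mono (ENNReal.mul_ne_top
          (ENNReal.inv_ne_top.2 (hcell0 n k)) hb.ne) h2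
        rw [ENNReal.toReal_pow, toReal_enorm, Real.norm_eq_abs] at h3
        simp only [ha, if_pos hcl]
        nlinarith [sq_nonneg (|⨍ y in cell (η n) k, F j y| - 1)]
      have := (Filter.isBoundedUnder_of_eventually_le hev).bddAbove_range
      obtain ⟨B, hB⟩ := this
      exact ⟨B, fun j => hB (mem_range_self j)⟩
    · exact ⟨0, fun j => by simp [ha, hcl]⟩
  choose B hB using habd
  -- Sequential compactness of a countable product of intervals replaces the diagonal argument.
  obtain ⟨a', -, s, hs, hlim⟩ := (isCompact_univ_pi fun p =>
    isCompact_Icc (a := -B p) (b := B p)).tendsto_subseq (x := a)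
    (fun j p _ => abs_le.1 (hB p j))
  have hlim' := tendsto_pi_nhds.1 hlim
  have hrs : Tendsto (fun i => r (s i)) atTop (𝓝 0) := hr.comp hs.tendsto_atTop
  obtain ⟨w, hw⟩ := exists_tendstoL2Loc_of_cauchy hΩ hΩb (f := fun i => F (s i))
    (fun i C hC => hFL _ C hC) (by
    intro C hC hCΩ e he
    obtain ⟨ρ, hρ, hρΩ⟩ := hC.exists_pos_closedBall_segment_subset hΩ 0
      (fun x hx t _ => by simpa using hCΩ hx)
    have hρΩ' : ∀ x ∈ C, Metric.closedBall x ρ ⊆ Ω := fun x hx => by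
      simpa using hρΩ x hx 0 (by simp)
    set K : ℝ := (2 * d : ℝ) ^ d + 1 with hK
    have hηlim : Tendsto η atTop (𝓝 0) :=
      tendsto_pow_atTop_nhds_zero_of_lt_one (by norm_num) (by norm_num)
    have hη1 : Tendsto (fun n => d * η n) atTop (𝓝 0) := by simpa using hηlim.const_mul (d : ℝ)
    have hη2 : Tendsto (fun n => K * (L * (d * η n))) atTop (𝓝 0) := by
      simpa using (hη1.const_mul L).const_mul K
    -- The cell side and the scale `r` will each cost e/8, and convergence of the cell averages e/4.
    -- Each function is then within e/2 of `A'`.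
    obtain ⟨n, hn1, hn2⟩ := ((hη1.eventually_lt_const (half_pos hρ)).and
      (hη2.eventually_lt_const (show 0 < e / 8 by positivity))).exists
    have hr2 : Tendsto (fun i => K * (L * r (s i))) atTop (𝓝 0) := by
      simpa using (hrs.const_mul L).const_mul K
    set A : ℕ → EuclideanSpace ℝ (Fin d) → ℝ := fun j x =>
      ⨍ y in cell (η n) (cellIndex (η n) x), F j y with hA
    set A' : EuclideanSpace ℝ (Fin d) → ℝ := fun x => a' (n, cellIndex (η n) x) with hA'
    have hmeasI : ∀ g : (Fin d → ℤ) → ℝ,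
        Measurable fun x : EuclideanSpace ℝ (Fin d) => g (cellIndex (η n) x) := fun g =>
      (measurable_of_countable g).comp (measurable_cellIndex (η n))
    have hAm : ∀ j, Measurable (A j) := fun j => hmeasI fun k => ⨍ y in cell (η n) k, F j y
    have hA'm : Measurable A' := hmeasI fun k => a' (n, k)
    have hfin := finite_image_cellIndex (hη0 n) hC.isBounded
    have hAA : ∀ᶠ i in atTop, eLpNorm (fun x => A (s i) x - A' x) 2 (volume.restrict C) ≤
        ENNReal.ofReal (e / 4) := by
      -- Only finitely many cells meet C, so coordinatewise convergence is uniform on C.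
      have h1 : Tendsto (fun i => ∑ k ∈ hfin.toFinset, |a (s i) (n, k) - a' (n, k)|) atTop
          (𝓝 0) := by
        rw [show (0 : ℝ) = ∑ k ∈ hfin.toFinset, |a' (n, k) - a' (n, k)| by simp]
        exact tendsto_finsetSum _ fun k _ => ((hlim' (n, k)).sub_const _).abs
      have h2 := ENNReal.Tendsto.const_mul (a := (volume.restrict C) univ ^ ((2 : ℝ≥0∞).toReal)⁻¹)
        (ENNReal.tendsto_ofReal h1)
        (Or.inr (ENNReal.rpow_ne_top_of_nonneg (by positivity)
          (by simpa using hC.measure_lt_top.ne)))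
      rw [ENNReal.ofReal_zero, mul_zero] at h2
      filter_upwards [h2.eventually_le_const (show 0 < ENNReal.ofReal (e / 4) by
        rw [ENNReal.ofReal_pos]; positivity)] with i hi
      refine (eLpNorm_le_of_ae_bound ?_).trans hi
      filter_upwards [ae_restrict_mem hC.measurableSet] with x hx
      have hcl : closure (cell (η n) (cellIndex (η n) x)) ⊆ Ω :=
        (closure_minimal (cell_subset_closedBall (hη0 n) x) Metric.isClosed_closedBall).trans
          ((Metric.closedBall_subset_closedBall (by linarith)).trans (hρΩ' x hx))
      have h3 : A (s i) x - A' x =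
          a (s i) (n, cellIndex (η n) x) - a' (n, cellIndex (η n) x) := by
        simp [ha, hA, hA', hcl]
      rw [h3]
      exact Finset.single_le_sum (f := fun k => |a (s i) (n, k) - a' (n, k)|)
        (fun k _ => abs_nonneg _) (hfin.mem_toFinset.2 (mem_image_of_mem _ hx))
    have hFA : ∀ᶠ i in atTop, eLpNorm (fun x => F (s i) x - A' x) 2 (volume.restrict C) ≤
        ENNReal.ofReal (e / 2) := by
      filter_upwards [hAA, hs.tendsto_atTop.eventually hFT,
        hrs.eventually_lt_const (half_pos hρ),
        hr2.eventually_lt_const (show 0 < e / 8 by positivity)] with i h1 h2 h3 h4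
      have h5 := h2.eLpNorm_cellAverage_sub_le hL (hr0 _) (hFm _) (hFi _) hC.measurableSet (hη0 n)
        (fun x hx => (Metric.closedBall_subset_closedBall (by linarith)).trans (hρΩ' x hx))
      have e1 : (fun x => F (s i) x - A' x) =
          (fun x => A (s i) x - A' x) - fun x => A (s i) x - F (s i) x := by
        ext x; simp
      rw [e1]
      refine (eLpNorm_sub_le ((hAm _).sub hA'm).aestronglyMeasurable
        ((hAm _).sub (hFm _)).aestronglyMeasurable one_le_two).trans ((add_le_add h1 h5).trans ?_)
      rw [← ENNReal.ofReal_add (by positivity)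
        (by have := hr0 (s i); have := (hη0 n).le; positivity)]
      refine ENNReal.ofReal_le_ofReal ?_
      have : K * (L * (d * η n + r (s i))) = K * (L * (d * η n)) + K * (L * r (s i)) := by ring
      linarith
    obtain ⟨N, hN⟩ := eventually_atTop.1 hFA
    refine ⟨N, fun i hi l hl => ?_⟩
    have e1 : (fun x => F (s i) x - F (s l) x) =
        (fun x => F (s i) x - A' x) - fun x => F (s l) x - A' x := by
      ext x; simp
    rw [e1]
    refine (eLpNorm_sub_le ((hFm _).sub hA'm).aestronglyMeasurable
      ((hFm _).sub hA'm).aestronglyMeasurable one_le_two).trans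
      ((add_le_add (hN i hi) (hN l hl)).trans ?_)
    rw [← ENNReal.ofReal_add (by positivity) (by positivity), add_halves])
  exact ⟨s, fun i => c (s i), w, hs, hw⟩

end Subsequence

/-! ### Bounds and measurability of the Kuhn interpolation -/

section Kuhn

variable {d : ℕ}

/-- The vertex of the lattice cube `k + [0,1]^d` selected by a set of coordinates. -/
def cubeVertex (k : Fin d → ℤ) (α : Finset (Fin d)) : Fin d → ℤ :=
  fun i => k i + if i ∈ α then 1 else 0

theorem kuhnVertex_eq_cubeVertex (k : Fin d → ℤ) (σ : Equiv.Perm (Fin d)) (m : ℕ) :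
    kuhnVertex k σ m = cubeVertex k (Finset.univ.filter fun i => (σ.symm i : ℕ) < m) := by
  ext i
  simp [kuhnVertex, cubeVertex]

/-- The base value contributes one deviation from b, and each of the d increments at most two, with
a coefficient in [0, 1). This is all that is used about the interpolation: it stays close to
whatever constant the vertex values are close to. -/
theorem abs_kuhnInterpolation_sub_le (ε : ℝ) (v : (Fin d → ℤ) → ℝ)
    (x : EuclideanSpace ℝ (Fin d)) (b : ℝ) :
    |kuhnInterpolation ε v x - b| ≤
      (2 * d + 1) * ∑ α : Finset (Fin d), |v (cubeVertex (cellIndex ε x) α) - b| := by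
  set k := cellIndex ε x with hk
  set S := ∑ α : Finset (Fin d), |v (cubeVertex k α) - b| with hS
  have hα : ∀ α, |v (cubeVertex k α) - b| ≤ S := fun α =>
    Finset.single_le_sum (f := fun α => |v (cubeVertex k α) - b|) (fun _ _ => abs_nonneg _)
      (Finset.mem_univ α)
  have h0 : |v k - b| ≤ S := by
    have := hα ∅
    rwa [show cubeVertex k ∅ = k by ext i; simp [cubeVertex]] at this
  set t : Fin d → ℝ := fun i => Int.fract (x i / ε)
  set σ : Equiv.Perm (Fin d) := Tuple.sort (fun i => -t i)
  have hkuhn : kuhnInterpolation ε v x = v k +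
      ∑ m : Fin d, t (σ m) * (v (kuhnVertex k σ (m + 1)) - v (kuhnVertex k σ m)) := rfl
  have hterm : ∀ m : Fin d,
      |t (σ m) * (v (kuhnVertex k σ (m + 1)) - v (kuhnVertex k σ m))| ≤ 2 * S := by
    intro m
    have h1 := hα (Finset.univ.filter fun i => (σ.symm i : ℕ) < m + 1)
    have h2 := hα (Finset.univ.filter fun i => (σ.symm i : ℕ) < m)
    rw [← kuhnVertex_eq_cubeVertex] at h1 h2
    rw [abs_mul, abs_of_nonneg (Int.fract_nonneg _)]
    have h3 : |v (kuhnVertex k σ (m + 1)) - v (kuhnVertex k σ m)| ≤ 2 * S := by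
      rw [abs_le] at h1 h2 ⊢
      constructor <;> linarith [h1.1, h1.2, h2.1, h2.2]
    calc _ ≤ 1 * |v (kuhnVertex k σ (m + 1)) - v (kuhnVertex k σ m)| :=
          mul_le_mul_of_nonneg_right (Int.fract_lt_one _).le (abs_nonneg _)
      _ ≤ _ := by rwa [one_mul]
  calc |kuhnInterpolation ε v x - b|
      = |(v k - b) +
          ∑ m : Fin d, t (σ m) * (v (kuhnVertex k σ (m + 1)) - v (kuhnVertex k σ m))| := by
        rw [hkuhn]; congr 1; ring
    _ ≤ |v k - b| + ∑ m : Fin d,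
          |t (σ m) * (v (kuhnVertex k σ (m + 1)) - v (kuhnVertex k σ m))| :=
        (abs_add_le _ _).trans (by gcongr; exact Finset.abs_sum_le_sum_abs _ _)
    _ ≤ S + ∑ _m : Fin d, 2 * S := add_le_add h0 (Finset.sum_le_sum fun m _ => hterm m)
    _ = _ := by simp; ring

/-- The discontinuous ingredients, the cell and the sorting permutation, take countably many values.
With both fixed, the formula is measurable in x. -/
theorem measurable_kuhnInterpolation (ε : ℝ) (v : (Fin d → ℤ) → ℝ) :
    Measurable (kuhnInterpolation ε v) := by
  let _ : MeasurableSpace (Equiv.Perm (Fin d)) := ⊤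
  set τ : EuclideanSpace ℝ (Fin d) → Equiv.Perm (Fin d) := fun x =>
    Tuple.sort (fun i => -Int.fract (x i / ε)) with hτ
  have hfr : ∀ i, Measurable fun x : EuclideanSpace ℝ (Fin d) => -Int.fract (x i / ε) := by
    intro i; fun_prop
  have hτm : Measurable τ := by
    refine measurable_to_countable' fun σ => ?_
    -- `Tuple.sort` is the unique sorting permutation that breaks ties by increasing index, which is
    -- a finite list of measurable conditions.
    have : τ ⁻¹' {σ} = (⋂ i : Fin d, ⋂ j : Fin d, ⋂ _ : i ≤ j,
        {x | -Int.fract (x (σ i) / ε) ≤ -Int.fract (x (σ j) / ε)}) ∩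
        ⋂ i : Fin d, ⋂ j : Fin d, ⋂ _ : i < j,
        {x | -Int.fract (x (σ i) / ε) = -Int.fract (x (σ j) / ε) → σ i < σ j} := by
      ext x
      simp only [mem_preimage, mem_singleton_iff, hτ, eq_comm (b := σ), Tuple.eq_sort_iff,
        mem_inter_iff, mem_iInter, mem_ofPred_eq]
      exact Iff.rfl
    rw [this]
    refine MeasurableSet.inter ?_ ?_
    · exact MeasurableSet.iInter fun i => MeasurableSet.iInter fun j => MeasurableSet.iInter
        fun _ => measurableSet_le (hfr _) (hfr _)
    · refine MeasurableSet.iInter fun i => MeasurableSet.iInter fun j => MeasurableSet.iInter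
        fun _ => ?_
      by_cases hij : σ i < σ j
      · simp [hij]
      · simp only [hij, imp_false]
        exact (measurableSet_eq_fun (β := ℝ) (hfr (σ i)) (hfr (σ j))).compl
  set H : ((Fin d → ℤ) × Equiv.Perm (Fin d)) → EuclideanSpace ℝ (Fin d) → ℝ := fun p x =>
    v p.1 + ∑ m : Fin d, Int.fract (x (p.2 m) / ε) *
      (v (kuhnVertex p.1 p.2 (m + 1)) - v (kuhnVertex p.1 p.2 m)) with hH
  have hHm : Measurable (Function.uncurry H) := by
    refine measurable_from_prod_countable_right fun p => ?_
    simp only [Function.uncurry, hH]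
    fun_prop
  exact hHm.comp (((measurable_cellIndex ε).prodMk hτm).prodMk measurable_id)

theorem memLp_kuhnInterpolation {ε : ℝ} (hε : 0 < ε) (v : (Fin d → ℤ) → ℝ)
    {C : Set (EuclideanSpace ℝ (Fin d))} (hC : IsCompact C) :
    MemLp (kuhnInterpolation ε v) 2 (volume.restrict C) := by
  have : IsFiniteMeasure (volume.restrict C) := ⟨by simpa using hC.measure_lt_top⟩
  have hfin := finite_image_cellIndex hε hC.isBounded
  refine MemLp.of_bound (measurable_kuhnInterpolation ε v).aestronglyMeasurable
    (∑ k ∈ hfin.toFinset, (2 * d + 1) * ∑ α : Finset (Fin d), |v (cubeVertex k α)|) ?_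
  filter_upwards [ae_restrict_mem hC.measurableSet] with x hx
  have h1 := abs_kuhnInterpolation_sub_le ε v x 0
  simp only [sub_zero] at h1
  refine h1.trans (Finset.single_le_sum
    (f := fun k => (2 * d + 1 : ℝ) * ∑ α : Finset (Fin d), |v (cubeVertex k α)|)
    (fun k _ => by positivity) (hfin.mem_toFinset.2 (mem_image_of_mem _ hx)))

end Kuhn

/-! ### Density of the dilated periodic set at scales above its period -/

section Density

variable {d : ℕ}

/-- Integrating a local integral over a set of centres costs at most the volume of a ball. -/
theorem lintegral_lintegral_inter_closedBall_le {M N : Set (EuclideanSpace ℝ (Fin d))} (ρ : ℝ)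
    {G : EuclideanSpace ℝ (Fin d) → ℝ≥0∞} (hG : Measurable G) :
    ∫⁻ x in N, ∫⁻ y in M ∩ Metric.closedBall x ρ, G y ≤
      volume (Metric.closedBall (0 : EuclideanSpace ℝ (Fin d)) ρ) * ∫⁻ y in M, G y := by
  set T : Set (EuclideanSpace ℝ (Fin d) × EuclideanSpace ℝ (Fin d)) :=
    {z | dist z.2 z.1 ≤ ρ} with hT
  have hTm : MeasurableSet T := by
    have : IsClosed T := isClosed_le (by fun_prop) continuous_const
    exact this.measurableSet
  set H : EuclideanSpace ℝ (Fin d) × EuclideanSpace ℝ (Fin d) → ℝ≥0∞ :=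
    T.indicator fun z => G z.2 with hH
  have hHm : Measurable H := (hG.comp measurable_snd).indicator hTm
  have h1 : ∀ x, ∫⁻ y in M ∩ Metric.closedBall x ρ, G y = ∫⁻ y in M, H (x, y) := by
    intro x
    rw [inter_comm, ← Measure.restrict_restrict Metric.isClosed_closedBall.measurableSet,
      ← lintegral_indicator Metric.isClosed_closedBall.measurableSet]
    rfl
  have h2 : ∀ y, ∫⁻ x in N, H (x, y) ≤
      volume (Metric.closedBall (0 : EuclideanSpace ℝ (Fin d)) ρ) * G y := by
    intro y
    calc ∫⁻ x in N, H (x, y) ≤ ∫⁻ x, H (x, y) := setLIntegral_le_lintegral _ _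
      _ = ∫⁻ x, (Metric.closedBall y ρ).indicator (fun _ => G y) x := by
          refine lintegral_congr fun x => ?_
          simp only [hH, hT, indicator, mem_ofPred_eq, Metric.mem_closedBall, dist_comm y x]
      _ = _ := by
          rw [lintegral_indicator_const Metric.isClosed_closedBall.measurableSet, mul_comm,
            Measure.addHaar_closedBall_center]
  simp only [h1]
  rw [lintegral_lintegral_swap (f := fun x y => H (x, y)) hHm.aemeasurable]
  refine (lintegral_mono h2).trans (le_of_eq ?_)
  rw [lintegral_const_mul _ hG]

theorem IsInclusion.measurableSet_periodicSet {K : Set (EuclideanSpace ℝ (Fin d))}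
    (hK : IsInclusion K) : MeasurableSet (periodicSet K) := by
  obtain ⟨U, -, -, rfl⟩ := hK.closure_open
  exact MeasurableSet.iUnion fun k => isClosed_closure.measurableSet.const_vadd _

theorem volume_ball_of_pos (x : EuclideanSpace ℝ (Fin d)) {r : ℝ} (hr : 0 < r) :
    volume (Metric.ball x r) =
      ENNReal.ofReal (r ^ d) * volume (Metric.ball (0 : EuclideanSpace ℝ (Fin d)) 1) := by
  rw [Measure.addHaar_ball_of_pos _ _ hr, finrank_euclideanSpace_fin]

/-- The dilated periodic set occupies a fixed fraction of every ball that is large compared with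
the period. -/
theorem IsInclusion.exists_volume_ball_le {K : Set (EuclideanSpace ℝ (Fin d))}
    (hK : IsInclusion K) : ∃ κ > 0, ∃ a > 0, ∀ δ > 0, ∀ s, a * δ ≤ s →
      ∀ y : EuclideanSpace ℝ (Fin d),
        volume (Metric.ball (0 : EuclideanSpace ℝ (Fin d)) (κ * s)) ≤
          volume (δ • periodicSet K ∩ Metric.ball y s) := by
  obtain ⟨U, hU, hUc, hKU⟩ := hK.closure_open
  obtain ⟨p, hp⟩ := hUc.nonempty
  obtain ⟨ρ₁, hρ₁, hsub₁⟩ := Metric.isOpen_iff.1 hU p hp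
  set ρ := min ρ₁ 1 with hρ
  have hρ0 : 0 < ρ := lt_min hρ₁ one_pos
  have hρ1 : ρ ≤ 1 := min_le_right _ _
  have hsub : Metric.ball p ρ ⊆ K := by
    rw [hKU]
    exact (Metric.ball_subset_ball (min_le_left _ _)).trans (hsub₁.trans subset_closure)
  refine ⟨ρ / (2 * (d + 1)), by positivity, 2 * (d + 1), by positivity,
    fun δ hδ s hs y => ?_⟩
  -- Some lattice copy of the scaled ball in K has its centre within δd of any point, and its radius
  -- is at most δ.
  set A : ℝ := δ * (d + 1) with hA
  have hA0 : 0 < A := by positivity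
  have hAs : A ≤ s / 2 := by rw [hA]; linarith
  have hs0 : 0 < s := by linarith
  set E := δ • periodicSet K with hE
  have hEm : MeasurableSet E := hK.measurableSet_periodicSet.const_smul₀ δ
  have h1 : ∀ z : EuclideanSpace ℝ (Fin d),
      volume (Metric.ball (0 : EuclideanSpace ℝ (Fin d)) (δ * ρ)) ≤
        volume (E ∩ Metric.closedBall z A) := by
    intro z
    set k : Fin d → ℤ := fun i => ⌊z i / δ - p i⌋ with hk
    set q := latticeVec k + p with hq
    have hball : Metric.ball (δ • q) (δ * ρ) ⊆ E := by
      have h2 : δ • Metric.ball q ρ = Metric.ball (δ • q) (δ * ρ) := by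
        rw [_root_.smul_ball hδ.ne', Real.norm_of_nonneg hδ.le]
      rw [← h2]
      refine smul_set_mono fun x hx => mem_iUnion.2 ⟨k, ?_⟩
      rw [mem_vadd_set_iff_neg_vadd_mem]
      apply hsub
      rw [Metric.mem_ball, dist_eq_norm] at hx ⊢
      rw [vadd_eq_add, show -latticeVec k + x - p = x - q by rw [hq]; abel]
      exact hx
    have hqz : dist (δ • q) z ≤ δ * d := by
      rw [dist_eq_norm, mul_comm]
      refine EuclideanSpace.norm_le_of_forall_abs_le fun i => ?_
      have h3 := Int.floor_le (z i / δ - p i)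
      have h4 := Int.lt_floor_add_one (z i / δ - p i)
      have h5 : (δ • q - z) i = δ * ((⌊z i / δ - p i⌋ : ℝ) + p i - z i / δ) := by
        simp only [hq, hk, latticeVec, PiLp.sub_apply, PiLp.smul_apply, PiLp.add_apply,
          smul_eq_mul]
        field_simp
      rw [h5, abs_mul, abs_of_pos hδ]
      have h6 : |(⌊z i / δ - p i⌋ : ℝ) + p i - z i / δ| ≤ 1 := by
        rw [abs_le]; constructor <;> linarith
      nlinarith
    rw [← Measure.addHaar_ball_center volume (δ • q)]
    refine measure_mono (subset_inter hball fun x hx => ?_)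
    rw [Metric.mem_ball] at hx
    rw [Metric.mem_closedBall]
    have := dist_triangle x (δ • q) z
    nlinarith
  set M := E ∩ Metric.ball y s with hM
  -- Integrating the local density over centres z ∈ B(y, s/2) avoids counting lattice copies.
  -- Comparing radii, (δρ)(s/2) = A · κs with κ = ρ / (2(d + 1)).
  have h2 : volume (Metric.ball (0 : EuclideanSpace ℝ (Fin d)) (δ * ρ)) *
      volume (Metric.ball y (s / 2)) ≤
      volume (Metric.closedBall (0 : EuclideanSpace ℝ (Fin d)) A) * volume M := by
    have h3 := lintegral_lintegral_inter_closedBall_le (M := M) (N := Metric.ball y (s / 2)) A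
      (G := fun _ => 1) measurable_const
    simp only [lintegral_const, MeasurableSet.univ, Measure.restrict_apply, univ_inter,
      one_mul] at h3
    refine le_trans ?_ h3
    rw [← setLIntegral_const]
    refine setLIntegral_mono' Metric.isOpen_ball.measurableSet fun z hz => ?_
    refine (h1 z).trans (measure_mono fun x hx => ⟨⟨hx.1, ?_⟩, hx.2⟩)
    have h4 := dist_triangle x z y
    have h5 : dist x z ≤ A := hx.2
    rw [Metric.mem_ball] at hz ⊢
    linarith
  have h0 : volume (Metric.ball (0 : EuclideanSpace ℝ (Fin d)) A) ≠ 0 :=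
    (Metric.measure_ball_pos volume _ hA0).ne'
  have ht : volume (Metric.ball (0 : EuclideanSpace ℝ (Fin d)) A) ≠ ⊤ := measure_ball_lt_top.ne
  have e1 : volume (Metric.closedBall (0 : EuclideanSpace ℝ (Fin d)) A) =
      volume (Metric.ball (0 : EuclideanSpace ℝ (Fin d)) A) := by
    have := volume_closedBall_mul (d := d) 0 0 zero_le_one hA0
    simpa using this
  rw [e1] at h2
  rw [← ENNReal.mul_le_mul_iff_right h0 ht]
  refine le_trans (le_of_eq ?_) h2
  rw [volume_ball_of_pos _ hA0, volume_ball_of_pos _ (by positivity : 0 < ρ / (2 * (d + 1)) * s),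
    volume_ball_of_pos _ (by positivity : 0 < δ * ρ),
    volume_ball_of_pos _ (by positivity : 0 < s / 2), mul_mul_mul_comm,
    mul_mul_mul_comm (ENNReal.ofReal ((δ * ρ) ^ d)), ← ENNReal.ofReal_mul (by positivity),
    ← ENNReal.ofReal_mul (by positivity), ← mul_pow, ← mul_pow]
  congr 3
  rw [hA]
  field_simp

end Density

/-! ### From the energy to short-range differences -/

section Energy

variable {d : ℕ}

/-- A nontrivial radial nonincreasing kernel is bounded below near the origin. -/
theorem IsRadialKernel.exists_le (hd : 1 ≤ d) {φ : EuclideanSpace ℝ (Fin d) → ℝ}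
    (hφ : IsRadialKernel φ) (hφ_ne : ¬ φ =ᵐ[volume] 0) :
    ∃ r > 0, ∃ c > 0, ∀ ξ, ‖ξ‖ ≤ r → c ≤ φ ξ := by
  obtain ⟨⟨φ₀, hanti, hφ₀⟩, -⟩ := hφ
  by_contra hcon
  push Not at hcon
  apply hφ_ne
  -- A positive value at some ξ ≠ 0 would, by monotonicity, bound φ below on the whole ball of
  -- radius |ξ|.
  have hz : ∀ ξ, ξ ≠ 0 → φ ξ = 0 := by
    intro ξ hξ
    by_contra h
    have hpos : 0 < φ ξ := lt_of_le_of_ne (by rw [hφ₀]; exact NNReal.coe_nonneg _) (Ne.symm h)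
    obtain ⟨ξ', h1, h2⟩ := hcon ‖ξ‖ (norm_pos_iff.2 hξ) (φ ξ) hpos
    rw [hφ₀, hφ₀, NNReal.coe_lt_coe] at h2
    exact absurd (hanti (show ‖ξ'‖₊ ≤ ‖ξ‖₊ from h1)) (not_le.2 h2)
  -- Here d ≥ 1 matters: in dimension 0 the origin is not a null set.
  have : Nonempty (Fin d) := ⟨⟨0, hd⟩⟩
  have h0 : ∀ᵐ ξ : EuclideanSpace ℝ (Fin d), ξ ≠ 0 := by
    rw [ae_iff]
    simp
  filter_upwards [h0] with ξ hξ
  exact hz ξ hξ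

/-- The nonlocal energy controls the short-range differences. -/
theorem lintegral_lintegral_closedBall_le_nonlocalEnergy {φ : EuclideanSpace ℝ (Fin d) → ℝ}
    {r c : ℝ} (hc : 0 < c) (hφ : ∀ ξ, ‖ξ‖ ≤ r → c ≤ φ ξ)
    {Ω E : Set (EuclideanSpace ℝ (Fin d))} {δ ε : ℝ}
    (hε : 0 < ε) {u u' : EuclideanSpace ℝ (Fin d) → ℝ} (hu' : Measurable u')
    (huu' : u =ᵐ[volume.restrict Ω] u') :
    ∫⁻ x in Ω ∩ δ • E, ∫⁻ y in (Ω ∩ δ • E) ∩ Metric.closedBall x (r * ε), ‖u' x - u' y‖ₑ ^ 2 ≤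
      ENNReal.ofReal (ε ^ (d + 2) / c) * nonlocalEnergy φ Ω E δ ε u := by
  set A := Ω ∩ δ • E with hAdef
  have huA : ∀ᵐ x ∂(volume.restrict A), u x = u' x :=
    ae_mono (Measure.restrict_mono_set volume inter_subset_left) huu'
  have hprod : (volume : Measure (EuclideanSpace ℝ (Fin d) × EuclideanSpace ℝ (Fin d))).restrict
      (A ×ˢ A) = (volume.restrict A).prod (volume.restrict A) := by
    rw [Measure.prod_restrict]; rfl
  set T : Set (EuclideanSpace ℝ (Fin d) × EuclideanSpace ℝ (Fin d)) :=
    {z | dist z.2 z.1 ≤ r * ε} with hT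
  have hTm : MeasurableSet T := by
    have : IsClosed T := isClosed_le (by fun_prop) continuous_const
    exact this.measurableSet
  set H : EuclideanSpace ℝ (Fin d) × EuclideanSpace ℝ (Fin d) → ℝ≥0∞ :=
    T.indicator fun z => ‖u' z.1 - u' z.2‖ₑ ^ 2 with hH
  have hHm : Measurable H := by
    refine Measurable.indicator ?_ hTm
    fun_prop
  have h1 : ∀ x, ∫⁻ y in A ∩ Metric.closedBall x (r * ε), ‖u' x - u' y‖ₑ ^ 2 =
      ∫⁻ y in A, H (x, y) := by
    intro x
    rw [inter_comm, ← Measure.restrict_restrict Metric.isClosed_closedBall.measurableSet,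
      ← lintegral_indicator Metric.isClosed_closedBall.measurableSet]
    rfl
  simp only [h1]
  rw [← lintegral_prod _ hHm.aemeasurable, nonlocalEnergy, hprod, ← mul_assoc,
    ← ENNReal.ofReal_mul (by positivity),
    ← lintegral_const_mul' _ _ ENNReal.ofReal_ne_top]
  refine lintegral_mono_ae ?_
  filter_upwards [Measure.quasiMeasurePreserving_fst.ae huA,
    Measure.quasiMeasurePreserving_snd.ae huA] with z hz1 hz2
  rw [hH, hz1, hz2]
  by_cases hzT : z ∈ T
  · rw [indicator_of_mem hzT, Real.enorm_eq_ofReal_abs, ← ENNReal.ofReal_pow (abs_nonneg _),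
      ← ENNReal.ofReal_mul (by positivity)]
    refine ENNReal.ofReal_le_ofReal ?_
    have h2 : c ≤ φ (ε⁻¹ • (z.1 - z.2)) := by
      refine hφ _ ?_
      rw [norm_smul, norm_inv, Real.norm_of_nonneg hε.le, inv_mul_le_iff₀ hε, ← dist_eq_norm,
        dist_comm, mul_comm]
      exact hzT
    have h3 : ε ^ (d + 2) / c * (ε ^ 2)⁻¹ *
        (scaledKernel φ ε (z.1 - z.2) * |u' z.1 - u' z.2| ^ 2) =
        φ (ε⁻¹ • (z.1 - z.2)) / c * |u' z.1 - u' z.2| ^ 2 := by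
      rw [scaledKernel, pow_add]
      field_simp
    rw [h3]
    have h4 : 1 ≤ φ (ε⁻¹ • (z.1 - z.2)) / c := (one_le_div hc).2 h2
    nlinarith [sq_nonneg |u' z.1 - u' z.2|]
  · rw [indicator_of_notMem hzT]
    exact bot_le

end Energy

/-! ### The sliding average of u over A ∩ B(x, s) -/

section SlidingAverage

variable {d : ℕ}

/-- Written with an indicator on the product, the moving domain becomes fixed, so numerator and
denominator are both integrals depending measurably on x. -/
theorem measurable_setAverage_ball {A : Set (EuclideanSpace ℝ (Fin d))}
    {u : EuclideanSpace ℝ (Fin d) → ℝ} (hu : Measurable u) (s : ℝ) :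
    Measurable fun x => ⨍ y in A ∩ Metric.ball x s, u y := by
  have key : ∀ g : EuclideanSpace ℝ (Fin d) → ℝ, Measurable g →
      Measurable fun x => ∫ y in A ∩ Metric.ball x s, g y := by
    intro g hg
    set T : Set (EuclideanSpace ℝ (Fin d) × EuclideanSpace ℝ (Fin d)) :=
      {z | dist z.2 z.1 < s} with hT
    have hTm : MeasurableSet T := by
      have : IsOpen T := isOpen_lt (by fun_prop) continuous_const
      exact this.measurableSet
    have hHm : StronglyMeasurable (T.indicator fun z => g z.2) :=
      ((hg.comp measurable_snd).indicator hTm).stronglyMeasurable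
    have h1 : (fun x => ∫ y in A ∩ Metric.ball x s, g y) =
        fun x => ∫ y in A, T.indicator (fun z => g z.2) (x, y) := by
      ext x
      rw [inter_comm, ← Measure.restrict_restrict Metric.isOpen_ball.measurableSet,
        ← integral_indicator Metric.isOpen_ball.measurableSet]
      rfl
    rw [h1]
    exact hHm.integral_prod_right'.measurable
  have h2 : (fun x => ⨍ y in A ∩ Metric.ball x s, u y) = fun x =>
      (∫ y in A ∩ Metric.ball x s, (1 : ℝ))⁻¹ * ∫ y in A ∩ Metric.ball x s, u y := by
    ext x
    rw [setAverage_eq, smul_eq_mul]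
    simp
  rw [h2]
  exact (key _ measurable_const).inv.mul (key u hu)

/-- The set of centres of balls of radius `s` contained in `Ω`. -/
def ballInterior (Ω : Set (EuclideanSpace ℝ (Fin d))) (s : ℝ) : Set (EuclideanSpace ℝ (Fin d)) :=
  {x | Metric.ball x s ⊆ Ω}

variable {A Ω : Set (EuclideanSpace ℝ (Fin d))} {u : EuclideanSpace ℝ (Fin d) → ℝ} {s κ : ℝ}
  {D : ℝ≥0∞}

/-- Pointwise distance of `u z` to a sliding average centred at a nearby point. -/
theorem enorm_sq_setAverage_ball_sub_le (hs : 0 < s) (hκ : 0 < κ) (hui : IntegrableOn u A)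
    (hdens : ∀ x ∈ ballInterior Ω s,
      volume (Metric.ball (0 : EuclideanSpace ℝ (Fin d)) (κ * s)) ≤
        volume (A ∩ Metric.ball x s))
    {x z : EuclideanSpace ℝ (Fin d)} (hx : x ∈ ballInterior Ω s) (hxz : dist x z ≤ 3 * s) :
    ‖(⨍ y in A ∩ Metric.ball x s, u y) - u z‖ₑ ^ 2 ≤
      (volume (Metric.ball (0 : EuclideanSpace ℝ (Fin d)) (κ * s)))⁻¹ *
        ∫⁻ y in A ∩ Metric.closedBall z (4 * s), ‖u z - u y‖ₑ ^ 2 := by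
  have hm0 : 0 < volume (Metric.ball (0 : EuclideanSpace ℝ (Fin d)) (κ * s)) :=
    Metric.measure_ball_pos volume _ (by positivity)
  refine (enorm_sq_setAverage_sub_le (hm0.trans_le (hdens x hx)).ne'
    ((measure_mono inter_subset_right).trans_lt measure_ball_lt_top).ne
    (hui.mono_set inter_subset_left) (u z)).trans ?_
  refine mul_le_mul' (ENNReal.inv_le_inv.2 (hdens x hx)) ?_
  have hsub : Metric.ball x s ⊆ Metric.closedBall z (4 * s) := by
    intro y hy
    have h1 := dist_triangle y x z
    have h2 : dist y x < s := hy
    rw [Metric.mem_closedBall]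
    linarith
  refine (lintegral_mono_set (inter_subset_inter_right A hsub)).trans (le_of_eq ?_)
  refine lintegral_congr fun y => ?_
  rw [← enorm_neg, neg_sub]

theorem measurable_lintegral_inter_closedBall
    {G : EuclideanSpace ℝ (Fin d) × EuclideanSpace ℝ (Fin d) → ℝ≥0∞} (hG : Measurable G)
    (A : Set (EuclideanSpace ℝ (Fin d))) (ρ : ℝ) :
    Measurable fun z => ∫⁻ y in A ∩ Metric.closedBall z ρ, G (z, y) := by
  set T : Set (EuclideanSpace ℝ (Fin d) × EuclideanSpace ℝ (Fin d)) :=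
    {z | dist z.2 z.1 ≤ ρ} with hT
  have hTm : MeasurableSet T := by
    have : IsClosed T := isClosed_le (by fun_prop) continuous_const
    exact this.measurableSet
  have h1 : (fun z => ∫⁻ y in A ∩ Metric.closedBall z ρ, G (z, y)) =
      fun z => ∫⁻ y in A, T.indicator G (z, y) := by
    ext z
    rw [inter_comm, ← Measure.restrict_restrict Metric.isClosed_closedBall.measurableSet,
      ← lintegral_indicator Metric.isClosed_closedBall.measurableSet]
    rfl
  rw [h1]
  exact (hG.indicator hTm).lintegral_prod_right'

theorem measurable_lintegral_inter_closedBall_enorm_sq (hu : Measurable u) (ρ : ℝ) :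
    Measurable fun z => ∫⁻ y in A ∩ Metric.closedBall z ρ, ‖u z - u y‖ₑ ^ 2 :=
  measurable_lintegral_inter_closedBall (G := fun z => ‖u z.1 - u z.2‖ₑ ^ 2) (by fun_prop) A ρ

/-- The sliding average moves little under small translations. -/
theorem lintegral_setAverage_ball_translate_sub_le (hs : 0 < s) (hκ : 0 < κ) (hu : Measurable u)
    (hui : IntegrableOn u A)
    (hdens : ∀ x ∈ ballInterior Ω s,
      volume (Metric.ball (0 : EuclideanSpace ℝ (Fin d)) (κ * s)) ≤
        volume (A ∩ Metric.ball x s))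
    (hJ : ∫⁻ z in A, ∫⁻ y in A ∩ Metric.closedBall z (4 * s), ‖u z - u y‖ₑ ^ 2 ≤
      volume (Metric.ball (0 : EuclideanSpace ℝ (Fin d)) (κ * s)) * D)
    {C : Set (EuclideanSpace ℝ (Fin d))} {h : EuclideanSpace ℝ (Fin d)} (hC : MeasurableSet C)
    (hh : ‖h‖ ≤ s) (hC1 : ∀ x ∈ C, x ∈ ballInterior Ω s)
    (hC2 : ∀ x ∈ C, x + h ∈ ballInterior Ω s) :
    ∫⁻ x in C, ‖(⨍ y in A ∩ Metric.ball (x + h) s, u y) -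
      (⨍ y in A ∩ Metric.ball x s, u y)‖ₑ ^ 2 ≤ ENNReal.ofReal ((2 / κ) ^ d) * D := by
  set m := volume (Metric.ball (0 : EuclideanSpace ℝ (Fin d)) (κ * s)) with hm
  have hm0 : m ≠ 0 := (Metric.measure_ball_pos volume _ (by positivity)).ne'
  have hmt : m ≠ ⊤ := measure_ball_lt_top.ne
  set g : EuclideanSpace ℝ (Fin d) → ℝ≥0∞ := fun z =>
    ∫⁻ y in A ∩ Metric.closedBall z (4 * s), ‖u z - u y‖ₑ ^ 2 with hg
  have hgm : Measurable g := measurable_lintegral_inter_closedBall_enorm_sq hu _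
  -- Jensen is used twice: first on the average over B(x + h, s), with the other average as the
  -- constant, then on that other average with u(z) as the constant. All pairs (z, y) that occur are
  -- within 4s, the interaction range.
  have hpt : ∀ x ∈ C, ‖(⨍ y in A ∩ Metric.ball (x + h) s, u y) -
      (⨍ y in A ∩ Metric.ball x s, u y)‖ₑ ^ 2 ≤
      m⁻¹ * (m⁻¹ * ∫⁻ z in A ∩ Metric.closedBall x (2 * s), g z) := by
    intro x hx
    refine (enorm_sq_setAverage_sub_le
      (lt_of_lt_of_le (pos_iff_ne_zero.2 hm0) (hdens _ (hC2 x hx))).ne'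
      ((measure_mono inter_subset_right).trans_lt measure_ball_lt_top).ne
      (hui.mono_set inter_subset_left) _).trans ?_
    refine mul_le_mul' (ENNReal.inv_le_inv.2 (hdens _ (hC2 x hx))) ?_
    have hsub : A ∩ Metric.ball (x + h) s ⊆ A ∩ Metric.closedBall x (2 * s) := by
      refine inter_subset_inter_right A fun z hz => ?_
      have h1 := dist_triangle z (x + h) x
      have h2 : dist z (x + h) < s := hz
      have h3 : dist (x + h) x = ‖h‖ := by rw [dist_eq_norm, add_sub_cancel_left]
      rw [Metric.mem_closedBall]
      linarith
    refine (lintegral_mono_set hsub).trans ?_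
    rw [← lintegral_const_mul _ hgm]
    refine setLIntegral_mono (hgm.const_mul _) fun z hz => ?_
    rw [← enorm_neg, neg_sub]
    refine enorm_sq_setAverage_ball_sub_le hs hκ hui hdens (hC1 x hx) ?_
    have : dist z x ≤ 2 * s := hz.2
    rw [dist_comm]
    linarith
  refine (setLIntegral_mono' hC hpt).trans ?_
  rw [lintegral_const_mul' _ _ (ENNReal.inv_ne_top.2 hm0),
    lintegral_const_mul' _ _ (ENNReal.inv_ne_top.2 hm0)]
  calc m⁻¹ * (m⁻¹ * ∫⁻ x in C, ∫⁻ z in A ∩ Metric.closedBall x (2 * s), g z)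
      ≤ m⁻¹ * (m⁻¹ * (volume (Metric.closedBall (0 : EuclideanSpace ℝ (Fin d)) (2 * s)) *
          (m * D))) := by
        gcongr
        exact (lintegral_lintegral_inter_closedBall_le _ hgm).trans (by gcongr)
    _ = m⁻¹ * (volume (Metric.closedBall (0 : EuclideanSpace ℝ (Fin d)) (2 * s)) *
          ((m⁻¹ * m) * D)) := by ring
    _ = _ := by
        rw [ENNReal.inv_mul_cancel hm0 hmt, one_mul,
          show 2 * s = (2 / κ) * (κ * s) by field_simp, hm,
          volume_closedBall_div_le _ _ (by positivity) (by positivity)]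

/-- The sliding average satisfies a translation bound. -/
theorem translationBound_setAverage_ball (hs : 0 < s) (hκ : 0 < κ) (hu : Measurable u)
    (hui : IntegrableOn u A)
    (hdens : ∀ x ∈ ballInterior Ω s,
      volume (Metric.ball (0 : EuclideanSpace ℝ (Fin d)) (κ * s)) ≤
        volume (A ∩ Metric.ball x s)) {Θ : ℝ} (hΘ : 0 ≤ Θ)
    (hJ : ∫⁻ z in A, ∫⁻ y in A ∩ Metric.closedBall z (4 * s), ‖u z - u y‖ₑ ^ 2 ≤
      volume (Metric.ball (0 : EuclideanSpace ℝ (Fin d)) (κ * s)) *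
        ENNReal.ofReal (Θ * s) ^ 2) :
    TranslationBound Ω s (√((2 / κ) ^ d) * Θ) (fun x => ⨍ y in A ∩ Metric.ball x s, u y) := by
  set U : EuclideanSpace ℝ (Fin d) → ℝ := fun x => ⨍ y in A ∩ Metric.ball x s, u y with hU
  have hUm : Measurable U := measurable_setAverage_ball hu s
  set T := √((2 / κ) ^ d) * Θ with hT
  have hT0 : 0 ≤ T := by positivity
  have hstep : ∀ (C : Set (EuclideanSpace ℝ (Fin d))) (h : EuclideanSpace ℝ (Fin d)),
      MeasurableSet C → ‖h‖ ≤ s → (∀ x ∈ C, x ∈ ballInterior Ω s) →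
      (∀ x ∈ C, x + h ∈ ballInterior Ω s) →
      eLpNorm (fun x => U (x + h) - U x) 2 (volume.restrict C) ≤ ENNReal.ofReal (T * s) := by
    intro C h hC hh h1 h2
    rw [eLpNorm_two_le_iff]
    refine (lintegral_setAverage_ball_translate_sub_le hs hκ hu hui hdens hJ hC hh h1 h2).trans
      (le_of_eq ?_)
    rw [← ENNReal.ofReal_pow (by positivity), ← ENNReal.ofReal_pow (by positivity),
      ← ENNReal.ofReal_mul (by positivity), hT, mul_assoc, mul_pow _ (Θ * s),
      Real.sq_sqrt (by positivity)]
  have hiter : ∀ (n : ℕ) (C : Set (EuclideanSpace ℝ (Fin d))) (h : EuclideanSpace ℝ (Fin d)),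
      MeasurableSet C → ‖h‖ ≤ n * s →
      (∀ x ∈ C, ∀ t ∈ Icc (0 : ℝ) 1, Metric.closedBall (x + t • h) s ⊆ Ω) →
      eLpNorm (fun x => U (x + h) - U x) 2 (volume.restrict C) ≤
        n * ENNReal.ofReal (T * s) := by
    intro n
    induction n with
    | zero =>
      intro C h _ hh _
      have h0 : h = 0 := by simpa using hh
      simp [h0]
    | succ n ih =>
      intro C h hC hh hseg
      -- The first n of n + 1 equal pieces of the segment go to the induction hypothesis. The last
      -- piece has length at most s.
      set t₀ : ℝ := n / (n + 1) with ht₀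
      have hn : (0 : ℝ) < n + 1 := by positivity
      have ht₀' : t₀ ∈ Icc (0 : ℝ) 1 :=
        ⟨by positivity, (div_le_one hn).2 (by linarith)⟩
      have h1t : 1 - t₀ = 1 / (n + 1) := by rw [ht₀]; field_simp; ring
      push_cast at hh
      have hn1 : ‖t₀ • h‖ ≤ n * s := by
        rw [norm_smul, Real.norm_of_nonneg ht₀'.1, ht₀, div_mul_eq_mul_div, div_le_iff₀ hn]
        nlinarith [Nat.cast_nonneg (α := ℝ) n]
      have hn2 : ‖(1 - t₀) • h‖ ≤ s := by
        rw [norm_smul, h1t, Real.norm_of_nonneg (by positivity), div_mul_eq_mul_div,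
          div_le_iff₀ hn]
        linarith
      have hball : ∀ x ∈ C, ∀ t ∈ Icc (0 : ℝ) 1, x + t • h ∈ ballInterior Ω s :=
        fun x hx t ht => Metric.ball_subset_closedBall.trans (hseg x hx t ht)
      have hadd : ∀ x, x + t₀ • h + (1 - t₀) • h = x + h := by intro x; module
      have h1 := ih C (t₀ • h) hC hn1 (fun x hx t ht => by
        rw [smul_smul]
        exact hseg x hx _ ⟨mul_nonneg ht.1 ht₀'.1, mul_le_one₀ ht.2 ht₀'.1 ht₀'.2⟩)
      have h2 := hstep ((fun x => x + t₀ • h) '' C) ((1 - t₀) • h)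
        ((measurableEmbedding_addRight (t₀ • h)).measurableSet_image.2 hC) hn2
        (by
          rintro _ ⟨x, hx, rfl⟩
          exact hball x hx t₀ ht₀')
        (by
          rintro _ ⟨x, hx, rfl⟩
          simp only [hadd]
          simpa using hball x hx 1 (by simp))
      rw [← eLpNorm_comp_add_right_restrict volume (fun x => U (x + (1 - t₀) • h) - U x) 2 C
        (t₀ • h)] at h2
      simp only [hadd] at h2
      have e : (fun x => U (x + h) - U x) =
          (fun x => U (x + t₀ • h) - U x) + fun x => U (x + h) - U (x + t₀ • h) := by
        ext x; simp
      rw [e]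
      refine (eLpNorm_add_le (by fun_prop) (by fun_prop) one_le_two).trans
        ((add_le_add h1 h2).trans (le_of_eq ?_))
      push_cast
      ring
  intro C h hC hh
  -- Rounding the number of steps up is what produces the extra s in |h| + s.
  refine (hiter ⌈‖h‖ / s⌉₊ C h hC ?_ hh).trans ?_
  · rw [← div_le_iff₀ hs]
    exact Nat.le_ceil _
  · rw [← ENNReal.ofReal_natCast, ← ENNReal.ofReal_mul (by positivity)]
    refine ENNReal.ofReal_le_ofReal ?_
    have h1 := (Nat.ceil_lt_add_one (by positivity : 0 ≤ ‖h‖ / s)).le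
    calc (⌈‖h‖ / s⌉₊ : ℝ) * (T * s) ≤ (‖h‖ / s + 1) * (T * s) := by gcongr
      _ = T * (‖h‖ + s) := by field_simp

/-- Averages of `u` over sets of comparable size are close to the sliding average. -/
theorem lintegral_setAverage_sub_setAverage_ball_le (hs : 0 < s) (hκ : 0 < κ) (hu : Measurable u)
    (hui : IntegrableOn u A)
    (hdens : ∀ x ∈ ballInterior Ω s,
      volume (Metric.ball (0 : EuclideanSpace ℝ (Fin d)) (κ * s)) ≤
        volume (A ∩ Metric.ball x s)) {Θ : ℝ} (hΘ : 0 ≤ Θ)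
    (hJ : ∫⁻ z in A, ∫⁻ y in A ∩ Metric.closedBall z (4 * s), ‖u z - u y‖ₑ ^ 2 ≤
      volume (Metric.ball (0 : EuclideanSpace ℝ (Fin d)) (κ * s)) *
        ENNReal.ofReal (Θ * s) ^ 2)
    {C : Set (EuclideanSpace ℝ (Fin d))} (hC : MeasurableSet C) {b κ' : ℝ} (hb : 0 ≤ b)
    (hκ' : 0 < κ') (hCΩ : ∀ x ∈ C, Metric.closedBall x (b * s + s) ⊆ Ω)
    {Q : EuclideanSpace ℝ (Fin d) → Set (EuclideanSpace ℝ (Fin d))}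
    (hQ : ∀ x ∈ C, Q x ⊆ Metric.closedBall x (b * s))
    (hQv : ∀ x ∈ C, volume (Metric.ball (0 : EuclideanSpace ℝ (Fin d)) (κ' * s)) ≤
      volume (A ∩ Q x)) :
    ∫⁻ x in C, ‖(⨍ y in A ∩ Q x, u y) - (⨍ y in A ∩ Metric.ball x s, u y)‖ₑ ^ 2 ≤
      ENNReal.ofReal ((b / κ') ^ d) * (2 * ENNReal.ofReal (Θ * s) ^ 2 +
        2 * ENNReal.ofReal (√((2 / κ) ^ d) * Θ * (b * s + s)) ^ 2) := by
  set U : EuclideanSpace ℝ (Fin d) → ℝ := fun x => ⨍ y in A ∩ Metric.ball x s, u y with hU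
  have hUm : Measurable U := measurable_setAverage_ball hu s
  set T := √((2 / κ) ^ d) * Θ with hT
  have hTB : TranslationBound Ω s T U :=
    translationBound_setAverage_ball hs hκ hu hui hdens hΘ hJ
  set m := volume (Metric.ball (0 : EuclideanSpace ℝ (Fin d)) (κ * s)) with hm
  have hm0 : m ≠ 0 := (Metric.measure_ball_pos volume _ (by positivity)).ne'
  have hmt : m ≠ ⊤ := measure_ball_lt_top.ne
  set m' := volume (Metric.ball (0 : EuclideanSpace ℝ (Fin d)) (κ' * s)) with hm'
  have hm0' : m' ≠ 0 := (Metric.measure_ball_pos volume _ (by positivity)).ne'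
  set M := A ∩ ballInterior Ω s with hM
  have hbs : 0 ≤ b * s := by positivity
  have hnear : ∀ x ∈ C, ∀ y ∈ Metric.closedBall x (b * s), y ∈ ballInterior Ω s := by
    intro x hx y hy z hz
    apply hCΩ x hx
    rw [Metric.mem_closedBall] at hy ⊢
    rw [Metric.mem_ball] at hz
    have := dist_triangle z y x
    linarith
  -- On A, u itself is close to U. In `hpt`, u(y) − U(x) is split through U(y): the first part is
  -- this estimate, the second the translation bound for U.
  have hu2 : ∫⁻ y in M, ‖u y - U y‖ₑ ^ 2 ≤ ENNReal.ofReal (Θ * s) ^ 2 := by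
    have h1 : ∫⁻ y in M, ‖u y - U y‖ₑ ^ 2 ≤ ∫⁻ z in M, m⁻¹ *
        ∫⁻ y in A ∩ Metric.closedBall z (4 * s), ‖u z - u y‖ₑ ^ 2 := by
      refine setLIntegral_mono
        ((measurable_lintegral_inter_closedBall_enorm_sq hu _).const_mul _) fun z hz => ?_
      rw [← enorm_neg, neg_sub]
      refine enorm_sq_setAverage_ball_sub_le hs hκ hui hdens hz.2 ?_
      rw [dist_self]
      positivity
    refine h1.trans ?_
    rw [lintegral_const_mul' _ _ (ENNReal.inv_ne_top.2 hm0)]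
    calc _ ≤ m⁻¹ * (m * ENNReal.ofReal (Θ * s) ^ 2) := by
          gcongr
          exact (lintegral_mono_set inter_subset_left).trans hJ
      _ = _ := by rw [← mul_assoc, ENNReal.inv_mul_cancel hm0 hmt, one_mul]
  have hpt : ∀ x ∈ C, ‖(⨍ y in A ∩ Q x, u y) - U x‖ₑ ^ 2 ≤
      m'⁻¹ * (2 * (∫⁻ y in M ∩ Metric.closedBall x (b * s), ‖u y - U y‖ₑ ^ 2) +
        2 * ∫⁻ y in Metric.closedBall x (b * s), ‖U y - U x‖ₑ ^ 2) := by
    intro x hx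
    refine (enorm_sq_setAverage_sub_le
      (lt_of_lt_of_le (pos_iff_ne_zero.2 hm0') (hQv x hx)).ne'
      ((measure_mono (inter_subset_right.trans (hQ x hx))).trans_lt
        measure_closedBall_lt_top).ne
      (hui.mono_set inter_subset_left) _).trans ?_
    refine mul_le_mul' (ENNReal.inv_le_inv.2 (hQv x hx)) ?_
    have hsub : A ∩ Q x ⊆ M ∩ Metric.closedBall x (b * s) := fun y hy =>
      ⟨⟨hy.1, hnear x hx y (hQ x hx hy.2)⟩, hQ x hx hy.2⟩
    refine (lintegral_mono_set hsub).trans ?_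
    refine (lintegral_mono fun y => enorm_sub_sq_le (u y) (U y) (U x)).trans ?_
    rw [lintegral_add_left (by fun_prop), lintegral_const_mul _ (by fun_prop),
      lintegral_const_mul _ (by fun_prop)]
    gcongr
    exact inter_subset_right
  refine (setLIntegral_mono' hC hpt).trans ?_
  rw [lintegral_const_mul' _ _ (ENNReal.inv_ne_top.2 hm0')]
  have hI1 : ∫⁻ x in C, ∫⁻ y in M ∩ Metric.closedBall x (b * s), ‖u y - U y‖ₑ ^ 2 ≤
      volume (Metric.closedBall (0 : EuclideanSpace ℝ (Fin d)) (b * s)) *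
        ENNReal.ofReal (Θ * s) ^ 2 :=
    (lintegral_lintegral_inter_closedBall_le _ (by fun_prop)).trans (by gcongr)
  have hI2 : ∫⁻ x in C, ∫⁻ y in Metric.closedBall x (b * s), ‖U y - U x‖ₑ ^ 2 ≤
      volume (Metric.closedBall (0 : EuclideanSpace ℝ (Fin d)) (b * s)) *
        ENNReal.ofReal (T * (b * s + s)) ^ 2 := by
    refine lintegral_lintegral_closedBall_enorm_sq_le volume hUm C fun h hh => ?_
    rw [mem_closedBall_zero_iff] at hh
    rw [← eLpNorm_two_le_iff]
    refine (hTB C h hC fun x hx t ht => ?_).trans (ENNReal.ofReal_le_ofReal (by gcongr))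
    refine subset_trans (Metric.closedBall_subset_closedBall' ?_) (hCΩ x hx)
    rw [dist_eq_norm, add_sub_cancel_left, norm_smul, Real.norm_of_nonneg ht.1]
    nlinarith [ht.2, norm_nonneg h]
  have hmeas1 : Measurable fun x =>
      ∫⁻ y in M ∩ Metric.closedBall x (b * s), ‖u y - U y‖ₑ ^ 2 :=
    measurable_lintegral_inter_closedBall (G := fun z => ‖u z.2 - U z.2‖ₑ ^ 2) (by fun_prop) M _
  rw [lintegral_add_left (hmeas1.const_mul _), lintegral_const_mul' _ _ (by simp),
    lintegral_const_mul' _ _ (by simp)]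
  calc _ ≤ m'⁻¹ * (2 * (volume (Metric.closedBall (0 : EuclideanSpace ℝ (Fin d)) (b * s)) *
        ENNReal.ofReal (Θ * s) ^ 2) +
        2 * (volume (Metric.closedBall (0 : EuclideanSpace ℝ (Fin d)) (b * s)) *
        ENNReal.ofReal (T * (b * s + s)) ^ 2)) := by gcongr
    _ = m'⁻¹ * (volume (Metric.closedBall (0 : EuclideanSpace ℝ (Fin d)) (b * s)) *
        (2 * ENNReal.ofReal (Θ * s) ^ 2 + 2 * ENNReal.ofReal (T * (b * s + s)) ^ 2)) := by ring
    _ = _ := by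
        rw [show b * s = (b / κ') * (κ' * s) by field_simp, hm',
          volume_closedBall_div_le _ _ (by positivity) (by positivity)]

end SlidingAverage

/-! ### The translation bound for the interpolated cube averages -/

section Interpolation

variable {d : ℕ}

/-- Translation bounds are stable under perturbations that are small in `L²`. -/
theorem TranslationBound.of_eLpNorm_sub_le {Ω : Set (EuclideanSpace ℝ (Fin d))} {s r T Q : ℝ}
    {f U : EuclideanSpace ℝ (Fin d) → ℝ} (hU : TranslationBound Ω s T U) (hsr : s ≤ r)
    (hs : 0 ≤ s) (hT : 0 ≤ T) (hQ : 0 ≤ Q) (hfm : Measurable f) (hUm : Measurable U)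
    (hfU : ∀ C, MeasurableSet C → (∀ x ∈ C, Metric.closedBall x r ⊆ Ω) →
      eLpNorm (fun x => f x - U x) 2 (volume.restrict C) ≤ ENNReal.ofReal (Q * r)) :
    TranslationBound Ω r (T + 2 * Q) f := by
  intro C h hC hh
  have hr : 0 ≤ r := hs.trans hsr
  have h1 := hU C h hC fun x hx t ht =>
    (Metric.closedBall_subset_closedBall hsr).trans (hh x hx t ht)
  have h2 := hfU C hC fun x hx => by simpa using hh x hx 0 (by simp)
  have h3 := hfU ((fun x => x + h) '' C)
    ((measurableEmbedding_addRight h).measurableSet_image.2 hC) (by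
      rintro _ ⟨x, hx, rfl⟩
      simpa using hh x hx 1 (by simp))
  rw [← eLpNorm_comp_add_right_restrict volume (fun x => f x - U x) 2 C h] at h3
  have e : (fun x => f (x + h) - f x) =
      ((fun x => f (x + h) - U (x + h)) + fun x => U (x + h) - U x) - fun x => f x - U x := by
    ext x; simp
  rw [e]
  refine (eLpNorm_sub_le (by fun_prop) (by fun_prop) one_le_two).trans ?_
  refine (add_le_add ((eLpNorm_add_le (by fun_prop) (by fun_prop) one_le_two).trans
    (add_le_add h3 h1)) h2).trans ?_
  rw [← ENNReal.ofReal_add (by positivity) (by positivity),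
    ← ENNReal.ofReal_add (by positivity) (by positivity)]
  refine ENNReal.ofReal_le_ofReal ?_
  nlinarith [mul_le_mul_of_nonneg_left hsr hT, mul_nonneg hQ (norm_nonneg h)]

theorem cell_subset_latticeCube {ε : ℝ} (hε : 0 < ε) (k : Fin d → ℤ) :
    cell ε k ⊆ latticeCube ε k := by
  rw [cell_eq_setOf hε]
  exact fun x hx i => ⟨(hx i).1, (hx i).2.le⟩

/-- In each coordinate the cube at a vertex of the cell of x reaches at most one cell beyond that of
x, hence the factor 2. -/
theorem latticeCube_cubeVertex_subset_closedBall {ε : ℝ} (hε : 0 < ε)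
    (x : EuclideanSpace ℝ (Fin d)) (α : Finset (Fin d)) :
    latticeCube ε (cubeVertex (cellIndex ε x) α) ⊆ Metric.closedBall x (d * (2 * ε)) := by
  intro y hy
  rw [mem_closedBall_iff_norm]
  refine EuclideanSpace.norm_le_of_forall_abs_le fun i => ?_
  have hx : x ∈ cell ε (cellIndex ε x) := rfl
  rw [cell_eq_setOf hε] at hx
  have h1 := hx i
  have h2 := hy i
  have h3 : ((cubeVertex (cellIndex ε x) α i : ℤ) : ℝ) =
      cellIndex ε x i + if i ∈ α then 1 else 0 := by
    simp [cubeVertex]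
  rw [h3] at h2
  rw [PiLp.sub_apply, abs_le]
  split_ifs at h2 <;> constructor <;> nlinarith [h1.1, h1.2, h2.1, h2.2]

/-- The piecewise-affine interpolations of the cube averages satisfy a translation bound that is
uniform among functions of bounded nonlocal energy. -/
theorem exists_translationBound_kuhnInterpolation (hd : 1 ≤ d)
    {φ : EuclideanSpace ℝ (Fin d) → ℝ} (hφ : IsRadialKernel φ) (hφ_ne : ¬ φ =ᵐ[volume] 0)
    {K : Set (EuclideanSpace ℝ (Fin d))} (hK : IsInclusion K)
    {Ω : Set (EuclideanSpace ℝ (Fin d))} (hΩb : Bornology.IsBounded Ω)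
    {M : ℝ≥0∞} (hM : M < ⊤) :
    ∃ a > 0, ∃ β > 0, ∃ L ≥ 0, ∀ ε > 0, ∀ δ > 0, a * δ ≤ ε →
      ∀ u : EuclideanSpace ℝ (Fin d) → ℝ, MemLp u 2 (volume.restrict Ω) →
      nonlocalEnergy φ Ω (periodicSet K) δ ε u ≤ M → ∀ v : (Fin d → ℤ) → ℝ,
      (∀ k, latticeCube ε k ⊆ Ω → v k = cubeAverage (periodicSet K) δ ε u k) →
      TranslationBound Ω (β * ε) L (kuhnInterpolation ε v) := by
  obtain ⟨r₀, hr₀, c₀, hc₀, hφc⟩ := hφ.exists_le hd hφ_ne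
  obtain ⟨κ, hκ, a₀, ha₀, hvol⟩ := hK.exists_volume_ball_le
  set V₁ := volume.real (Metric.ball (0 : EuclideanSpace ℝ (Fin d)) 1) with hV₁
  have hV₁0 : 0 < V₁ := ENNReal.toReal_pos
    (Metric.measure_ball_pos volume _ one_pos).ne' measure_ball_lt_top.ne
  have hV₁e : volume (Metric.ball (0 : EuclideanSpace ℝ (Fin d)) 1) = ENNReal.ofReal V₁ :=
    (ENNReal.ofReal_toReal measure_ball_lt_top.ne).symm
  -- The constants are fixed by s = r₀ε/4. `Θ` makes the energy bound equal to the volume of B(0,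
  -- κs) times (Θs)². `b` gives bs = 2dε, the reach of the neighbouring cubes, and `κ'` gives κ's =
  -- κε/2, where ε/2 is the radius of the ball inscribed in a cube.
  set Θ : ℝ := √(M.toReal / (c₀ * ((r₀ / 4) ^ (d + 2) * κ ^ d * V₁))) with hΘ
  set b : ℝ := 8 * d / r₀ with hb
  set κ' : ℝ := 2 * κ / r₀ with hκ'
  have hb0 : 0 ≤ b := by positivity
  have hκ0' : 0 < κ' := by positivity
  set T : ℝ := √((2 / κ) ^ d) * Θ with hT
  set P : ℝ := √((b / κ') ^ d * (2 * Θ ^ 2 + 2 * (T * (b + 1)) ^ 2)) with hP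
  set Q : ℝ := (2 * d + 1) * (2 ^ d * P) with hQ
  -- The first witness makes both radii s and ε/2 at least a₀δ, so the density estimate applies to
  -- sliding balls and to cubes. The second gives βε = bs + s.
  refine ⟨a₀ * (4 / r₀ + 2), by positivity, (b + 1) * (r₀ / 4), by positivity, T + 2 * Q,
    by positivity, fun ε hε δ hδ hδε u hu hE v hv => ?_⟩
  set s : ℝ := r₀ / 4 * ε with hs
  have hs0 : 0 < s := by positivity
  have hbs : b * s = d * (2 * ε) := by rw [hb, hs]; field_simp; ring
  have hδ1 : a₀ * δ ≤ s := by
    have h1 : a₀ * δ * (4 / r₀) ≤ ε := by nlinarith [mul_pos ha₀ hδ]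
    have h2 : a₀ * δ = a₀ * δ * (4 / r₀) * (r₀ / 4) := by field_simp
    rw [h2, hs, mul_comm (r₀ / 4)]
    gcongr
  have hδ2 : a₀ * δ ≤ ε / 2 := by
    have h1 : 0 < 4 / r₀ := by positivity
    nlinarith [mul_pos (mul_pos ha₀ hδ) h1]
  set E := periodicSet K with hEdef
  set A := Ω ∩ δ • E with hA
  have hfinΩ : IsFiniteMeasure (volume.restrict Ω) := ⟨by simpa using hΩb.measure_lt_top⟩
  -- A measurable representative has the same averages over subsets of Ω, and its short-range
  -- differences are bounded by the energy of u.
  obtain ⟨u', hu'm, huu'⟩ : ∃ u', Measurable u' ∧ u =ᵐ[volume.restrict Ω] u' :=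
    ⟨_, hu.1.stronglyMeasurable_mk.measurable, hu.1.ae_eq_mk⟩
  have hui : IntegrableOn u' A :=
    (((memLp_congr_ae huu').1 hu).integrable one_le_two).mono_measure
      (Measure.restrict_mono_set volume inter_subset_left)
  have hdens : ∀ x ∈ ballInterior Ω s,
      volume (Metric.ball (0 : EuclideanSpace ℝ (Fin d)) (κ * s)) ≤
        volume (A ∩ Metric.ball x s) := by
    intro x hx
    refine (hvol δ hδ s hδ1 x).trans (measure_mono ?_)
    exact fun y hy => ⟨⟨hx hy.2, hy.1⟩, hy.2⟩
  have hJ : ∫⁻ z in A, ∫⁻ y in A ∩ Metric.closedBall z (4 * s), ‖u' z - u' y‖ₑ ^ 2 ≤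
      volume (Metric.ball (0 : EuclideanSpace ℝ (Fin d)) (κ * s)) *
        ENNReal.ofReal (Θ * s) ^ 2 := by
    rw [show 4 * s = r₀ * ε by rw [hs]; ring]
    refine (lintegral_lintegral_closedBall_le_nonlocalEnergy hc₀ hφc hε hu'm huu').trans ?_
    refine (mul_le_mul_right hE _).trans (le_of_eq ?_)
    rw [volume_ball_of_pos _ (by positivity), hV₁e, ← ENNReal.ofReal_toReal hM.ne,
      ← ENNReal.ofReal_mul (by positivity), ← ENNReal.ofReal_pow (by positivity),
      ← ENNReal.ofReal_mul (by positivity), ← ENNReal.ofReal_mul (by positivity), mul_pow Θ,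
      hΘ, Real.sq_sqrt (by positivity), hs]
    congr 1
    have hq : 0 < r₀ / 4 := by positivity
    generalize r₀ / 4 = q at hq
    rw [mul_pow κ, mul_pow q, mul_pow q, pow_add, pow_add]
    field_simp
  set U : EuclideanSpace ℝ (Fin d) → ℝ := fun x => ⨍ y in A ∩ Metric.ball x s, u' y with hU
  have hUm : Measurable U := measurable_setAverage_ball hu'm s
  have hTB : TranslationBound Ω s T U :=
    translationBound_setAverage_ball hs0 hκ hu'm hui hdens (by positivity) hJ
  have hβ : (b + 1) * (r₀ / 4) * ε = b * s + s := by rw [hs]; ring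
  rw [hβ]
  refine hTB.of_eLpNorm_sub_le (by nlinarith) hs0.le (by positivity) (by positivity)
    (measurable_kuhnInterpolation ε v) hUm fun C hC hCΩ => ?_
  have hvm : ∀ α : Finset (Fin d), Measurable fun x : EuclideanSpace ℝ (Fin d) =>
      v (cubeVertex (cellIndex ε x) α) := fun α =>
    (measurable_of_countable fun k => v (cubeVertex k α)).comp (measurable_cellIndex ε)
  have hα : ∀ α : Finset (Fin d),
      eLpNorm (fun x => v (cubeVertex (cellIndex ε x) α) - U x) 2 (volume.restrict C) ≤
        ENNReal.ofReal (P * s) := by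
    intro α
    have hQsub : ∀ x : EuclideanSpace ℝ (Fin d), latticeCube ε (cubeVertex (cellIndex ε x) α) ⊆
        Metric.closedBall x (b * s) := fun x => by
      rw [hbs]
      exact latticeCube_cubeVertex_subset_closedBall hε x α
    -- Only cubes contained in Ω enter, so the arbitrary values of `v` play no role.
    have hQΩ : ∀ x ∈ C, latticeCube ε (cubeVertex (cellIndex ε x) α) ⊆ Ω := fun x hx =>
      (hQsub x).trans ((Metric.closedBall_subset_closedBall (by linarith)).trans (hCΩ x hx))
    have hset : ∀ x ∈ C, A ∩ latticeCube ε (cubeVertex (cellIndex ε x) α) =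
        δ • E ∩ latticeCube ε (cubeVertex (cellIndex ε x) α) := by
      intro x hx
      rw [hA, inter_comm Ω, inter_assoc, inter_eq_right.2 (hQΩ x hx)]
    have hval : ∀ x ∈ C, v (cubeVertex (cellIndex ε x) α) =
        ⨍ y in A ∩ latticeCube ε (cubeVertex (cellIndex ε x) α), u' y := by
      intro x hx
      rw [hv _ (hQΩ x hx), cubeAverage, setAverage_eq, smul_eq_mul, hset x hx]
      congr 1
      refine integral_congr_ae (ae_mono (Measure.restrict_mono_set volume ?_) huu')
      exact inter_subset_right.trans (hQΩ x hx)
    rw [eLpNorm_two_le_iff]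
    have h1 := lintegral_setAverage_sub_setAverage_ball_le hs0 hκ hu'm hui hdens
      (Real.sqrt_nonneg _) hJ hC hb0 hκ0' hCΩ
      (Q := fun x => latticeCube ε (cubeVertex (cellIndex ε x) α)) (fun x _ => hQsub x) (by
        intro x hx
        rw [hset x hx, show κ' * s = κ * (ε / 2) by rw [hκ', hs]; field_simp; ring]
        refine (hvol δ hδ (ε / 2) hδ2 (cellCenter ε (cubeVertex (cellIndex ε x) α))).trans
          (measure_mono (inter_subset_inter_right _ ?_))
        exact (ball_cellCenter_subset hε _).trans (cell_subset_latticeCube hε _))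
    refine (le_of_eq (setLIntegral_congr_fun hC fun x hx => ?_)).trans (h1.trans (le_of_eq ?_))
    · simp only [hval x hx, hU]
    · have h2 : ∀ y : ℝ, 0 ≤ y → (2 : ℝ≥0∞) * ENNReal.ofReal y ^ 2 =
          ENNReal.ofReal (2 * y ^ 2) := by
        intro y hy
        rw [ENNReal.ofReal_mul (by norm_num), ENNReal.ofReal_pow hy]
        simp
      rw [h2 _ (by positivity), h2 _ (by positivity), ← ENNReal.ofReal_add (by positivity)
        (by positivity), ← ENNReal.ofReal_mul (by positivity), ← ENNReal.ofReal_pow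
        (by positivity), mul_pow P, hP, Real.sq_sqrt (by positivity)]
      congr 1
      ring
  have hpt : ∀ x, ‖kuhnInterpolation ε v x - U x‖ ≤
      (2 * d + 1 : ℝ) * ‖(∑ α : Finset (Fin d),
        fun x => |v (cubeVertex (cellIndex ε x) α) - U x|) x‖ := by
    intro x
    refine (abs_kuhnInterpolation_sub_le ε v x (U x)).trans ?_
    rw [Finset.sum_apply]
    gcongr
    exact le_abs_self _
  refine (eLpNorm_le_mul_eLpNorm_of_ae_le_mul (ae_of_all _ hpt) 2).trans ?_
  have hsum : eLpNorm (∑ α : Finset (Fin d),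
      fun x => |v (cubeVertex (cellIndex ε x) α) - U x|) 2 (volume.restrict C) ≤
      ENNReal.ofReal (2 ^ d * (P * s)) := by
    refine (eLpNorm_sum_le (fun α _ => ?_) one_le_two).trans ?_
    · exact ((hvm α).sub hUm).norm.aestronglyMeasurable
    · calc _ ≤ ∑ _α : Finset (Fin d), ENNReal.ofReal (P * s) := by
            refine Finset.sum_le_sum fun α _ => ?_
            refine le_trans (le_of_eq ?_) (hα α)
            exact eLpNorm_norm (fun x => v (cubeVertex (cellIndex ε x) α) - U x)
        _ = _ := by
            rw [Finset.sum_const, Finset.card_univ, Fintype.card_finset, Fintype.card_fin,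
              nsmul_eq_mul, ENNReal.ofReal_mul (show (0 : ℝ) ≤ 2 ^ d by positivity)]
            simp
  refine (mul_le_mul_right hsum _).trans ?_
  rw [← ENNReal.ofReal_mul (by positivity)]
  refine ENNReal.ofReal_le_ofReal ?_
  calc (2 * d + 1 : ℝ) * (2 ^ d * (P * s)) = Q * s := by rw [hQ]; ring
    _ ≤ Q * (b * s + s) := by
      refine mul_le_mul_of_nonneg_left (by nlinarith) (by positivity)

end Interpolation

/-- The values `v ε k` at nodes `ε k` whose cube `ε (k + [0,1]^d)` is not contained in `Ω` are
arbitrary. -/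
theorem theorem2p4 {d : ℕ} (hd : 1 ≤ d)
    (φ : EuclideanSpace ℝ (Fin d) → ℝ) (hφ : IsRadialKernel φ) (hφ_ne : ¬ φ =ᵐ[volume] 0)
    (K : Set (EuclideanSpace ℝ (Fin d))) (hK : IsInclusion K)
    (Ω : Set (EuclideanSpace ℝ (Fin d))) (hΩ_open : IsOpen Ω) (hΩ_conn : IsConnected Ω)
    (hΩ_bdd : Bornology.IsBounded Ω) (hΩ_lip : HasLipschitzBoundary Ω)
    (δ : ℝ → ℝ) (hδ_pos : ∀ ε, 0 < ε → 0 < δ ε)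
    (hδ : Tendsto (fun ε => ε / δ ε) (𝓝[>] 0) atTop)
    (u : ℝ → EuclideanSpace ℝ (Fin d) → ℝ)
    (hu : ∀ ε, 0 < ε → MemLp (u ε) 2 (volume.restrict Ω))
    (hF : (⨆ ε ∈ Ioi (0 : ℝ), nonlocalEnergy φ Ω (periodicSet K) (δ ε) ε (u ε)) < ⊤)
    (v : ℝ → (Fin d → ℤ) → ℝ)
    (hv : ∀ ε, 0 < ε → ∀ k : Fin d → ℤ, latticeCube ε k ⊆ Ω →
      v ε k = cubeAverage (periodicSet K) (δ ε) ε (u ε) k)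
    (ε : ℕ → ℝ) (hε_pos : ∀ j, 0 < ε j) (hε : Tendsto ε atTop (𝓝 0)) :
    (∃ (s : ℕ → ℕ) (c : ℕ → ℝ) (w : EuclideanSpace ℝ (Fin d) → ℝ), StrictMono s ∧ MemH1 Ω w ∧
      TendstoL2Loc Ω (fun j x => kuhnInterpolation (ε (s j)) (v (ε (s j))) x + c j) w) ∧
    (∀ (s : ℕ → ℕ) (c : ℕ → ℝ) (w : EuclideanSpace ℝ (Fin d) → ℝ), StrictMono s →
      TendstoL2Loc Ω (fun j x => kuhnInterpolation (ε (s j)) (v (ε (s j))) x + c j) w →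
        MemH1 Ω w) := by
  obtain ⟨a, ha, β, hβ, L, hL, hmain⟩ :=
    exists_translationBound_kuhnInterpolation hd hφ hφ_ne hK hΩ_bdd hF
  -- The divergence of ε/δ is used only here, to have a · δ ≤ ε eventually.
  have hTB : ∀ s : ℕ → ℕ, StrictMono s → ∀ᶠ j in atTop,
      TranslationBound Ω (β * ε (s j)) L (kuhnInterpolation (ε (s j)) (v (ε (s j)))) := by
    intro s hs
    have hε' : Tendsto (fun j => ε (s j)) atTop (𝓝[>] 0) :=
      tendsto_nhdsWithin_iff.2 ⟨hε.comp hs.tendsto_atTop, Eventually.of_forall fun j => hε_pos _⟩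
    filter_upwards [(hδ.comp hε').eventually_ge_atTop a] with j hj
    refine hmain _ (hε_pos _) _ (hδ_pos _ (hε_pos _)) ?_ _ (hu _ (hε_pos _)) ?_ _
      (hv _ (hε_pos _))
    · exact (le_div_iff₀ (hδ_pos _ (hε_pos _))).1 hj
    · exact le_iSup₂ (f := fun e (_ : e ∈ Ioi (0 : ℝ)) =>
        nonlocalEnergy φ Ω (periodicSet K) (δ e) e (u e)) (ε (s j)) (hε_pos _)
  have hr : Tendsto (fun j => β * ε j) atTop (𝓝 0) := by simpa using hε.const_mul β
  have hH1 : ∀ (s : ℕ → ℕ) (c : ℕ → ℝ) (w : EuclideanSpace ℝ (Fin d) → ℝ), StrictMono s →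
      TendstoL2Loc Ω (fun j x => kuhnInterpolation (ε (s j)) (v (ε (s j))) x + c j) w →
        MemH1 Ω w := fun s c w hs hw =>
    hw.memH1 hΩ_open hΩ_bdd hΩ_lip hL (hr.comp hs.tendsto_atTop)
      ((hTB s hs).mono fun j hj => hj.add_const (c j))
  refine ⟨?_, hH1⟩
  obtain ⟨s, c, w, hs, hw⟩ := exists_subseq_tendstoL2Loc hΩ_open hΩ_conn hΩ_bdd hL
    (fun j => (mul_pos hβ (hε_pos j)).le) hr
    (fun j => measurable_kuhnInterpolation (ε j) (v (ε j)))
    (fun j C hC => memLp_kuhnInterpolation (hε_pos j) _ hC) (hTB id strictMono_id)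
  exact ⟨s, c, w, hs, hH1 s c w hs hw, hw⟩
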